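/- Let $H$ be a separable real Hilbert space, $A_0$ a non-negative self-adjoint (possibly unbounded) operator on $H$ with domain $D(A_0)$, and $\gamma>0$. Let $\mathscr H=D(A_0)\times H$ be the Hilbert space with squared norm $|(u,v)|_{\mathscr H}^2=|A_0u|_H^2+|u|_H^2+|v|_H^2$, and let $\mathscr A(u,v)=(v,-A_0^2u)$ with domain $D(\mathscr A)=D(A_0^2)\times D(A_0)$; $\mathscr A$ generates a $C_0$ group $(\mathscr S(t))_{t\in\mathbb R}$ on $\mathscr H$. Let $M=\{x\in H:|x|_H=1\}$ and, for $a\in M$, let $\Pi_a x=x-\langle x,a\rangle_H\,a$. Assume that $f\in L^2_{\mathrm{loc}}([0,\infty);H)$, i.e. $f\in L^2(0,T;H)$ for every $T>0$, and that $z_0=(u_0,v_0)\in\mathscr H$ satisfies $|u_0|_H=1$ and $\langle u_0,v_0\rangle_H=0$. Then there exists a unique function $z=(u,v)\in C([0,\infty);\mathscr H)$ such that $u\in C^1([0,\infty);M)$, $u_t(t)=v(t)$ for all $t\ge 0$, and $u$ is a mild solution, with initial data $(u_0,v_0)$, of $$u_{tt}(t)+|u_t(t)|_H^2\,u(t)=-A_0^2u(t)+|A_0u(t)|_H^2\,u(t)-\gamma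 u_t(t)+\Pi_{u(t)}f(t),$$ that is, for every $t\ge 0$, $$z(t)=\mathscr S(t)z_0+\int_0^t\mathscr S(t-s)\bigl(0,\,-|v(s)|_H^2u(s)+|A_0u(s)|_H^2u(s)-\gamma v(s)+\Pi_{u(s)}f(s)\bigr)\,ds .$$ Moreover, with $\Psi(u,v)=\tfrac12\bigl(|A_0u|_H^2+|v|_H^2\bigr)$, for every $t\ge 0$, $$\Psi(z(t))=\Psi(z_0)-\gamma\int_0^t|v(s)|_H^2\,ds+\int_0^t\langle v(s),f(s)\rangle_H\,ds .$$ -/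

import Mathlib

open Set Filter Topology MeasureTheory
open scoped InnerProductSpace

noncomputable section

namespace ConstrainedWave

section Domain

variable {H : Type*} [NormedAddCommGroup H] [InnerProductSpace ℝ H]

/-- The domain `D(A)` of an unbounded operator `A` on `H`, as a space of its own, to be endowed with
the graph inner product `⟪A u, A w⟫ + ⟪u, w⟫`. -/
def GraphDomain (A : H →ₗ.[ℝ] H) : Type _ := A.domain

namespace GraphDomain

variable (A : H →ₗ.[ℝ] H)

instance : AddCommGroup (GraphDomain A) := inferInstanceAs (AddCommGroup A.domain)

instance : Module ℝ (GraphDomain A) := inferInstanceAs (Module ℝ A.domain)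

/-- The inclusion `D(A) → H`. -/
def incl : GraphDomain A →ₗ[ℝ] H := A.domain.subtype

/-- The operator `A`, as an everywhere defined linear map `D(A) → H`. -/
def op : GraphDomain A →ₗ[ℝ] H := A.toFun

theorem incl_injective : Function.Injective (incl A) := Subtype.val_injective

/-- The graph inner product on `D(A)`. -/
@[reducible]
def core : InnerProductSpace.Core ℝ (GraphDomain A) where
  inner u w := ⟪op A u, op A w⟫_ℝ + ⟪incl A u, incl A w⟫_ℝ
  conj_inner_symm u w := by
    simp [real_inner_comm]
  re_inner_nonneg u := by
    simpa using add_nonneg (real_inner_self_nonneg (x := op A u))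
      (real_inner_self_nonneg (x := incl A u))
  add_left u w x := by
    simp only [map_add, inner_add_left]; ring
  smul_left u w r := by
    simp only [map_smul, real_inner_smul_left, conj_trivial]; ring
  definite u h := by
    have h1 : 0 ≤ ⟪op A u, op A u⟫_ℝ := real_inner_self_nonneg
    have h2 : 0 ≤ ⟪incl A u, incl A u⟫_ℝ := real_inner_self_nonneg
    have h3 : ⟪incl A u, incl A u⟫_ℝ = 0 := by
      change ⟪op A u, op A u⟫_ℝ + ⟪incl A u, incl A u⟫_ℝ = 0 at h
      linarith
    exact incl_injective A (by simpa using inner_self_eq_zero.mp h3)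

instance : NormedAddCommGroup (GraphDomain A) :=
  @InnerProductSpace.Core.toNormedAddCommGroup ℝ (GraphDomain A) _ _ _ (core A)

instance : InnerProductSpace ℝ (GraphDomain A) := InnerProductSpace.ofCore (core A).toCore

theorem inner_def (u w : GraphDomain A) :
    ⟪u, w⟫_ℝ = ⟪op A u, op A w⟫_ℝ + ⟪incl A u, incl A w⟫_ℝ := rfl

theorem norm_sq_eq (u : GraphDomain A) : ‖u‖ ^ 2 = ‖op A u‖ ^ 2 + ‖incl A u‖ ^ 2 := by
  rw [← real_inner_self_eq_norm_sq, inner_def, real_inner_self_eq_norm_sq,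
    real_inner_self_eq_norm_sq]

/-- `D(A)` is complete when `A` is closed (in particular when `A` is self-adjoint), so that Bochner
integrals in `D(A) × H` have their proper meaning. -/
theorem completeSpace [CompleteSpace H] (hA : A.IsClosed) : CompleteSpace (GraphDomain A) := by
  have hop : ∀ u : GraphDomain A, ‖op A u‖ ≤ ‖u‖ := fun u =>
    abs_le_of_sq_le_sq' (by nlinarith [norm_sq_eq A u, sq_nonneg ‖incl A u‖]) (norm_nonneg u) |>.2
  have hincl : ∀ u : GraphDomain A, ‖incl A u‖ ≤ ‖u‖ := fun u =>
    abs_le_of_sq_le_sq' (by nlinarith [norm_sq_eq A u, sq_nonneg ‖op A u‖]) (norm_nonneg u) |>.2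
  refine Metric.complete_of_cauchySeq_tendsto fun x hx => ?_
  have h1 : CauchySeq fun n => op A (x n) := by
    rw [Metric.cauchySeq_iff] at hx ⊢
    intro ε hε
    obtain ⟨N, hN⟩ := hx ε hε
    refine ⟨N, fun m hm n hn => lt_of_le_of_lt ?_ (hN m hm n hn)⟩
    rw [dist_eq_norm, dist_eq_norm, ← map_sub]
    exact hop _
  have h2 : CauchySeq fun n => incl A (x n) := by
    rw [Metric.cauchySeq_iff] at hx ⊢
    intro ε hε
    obtain ⟨N, hN⟩ := hx ε hε
    refine ⟨N, fun m hm n hn => lt_of_le_of_lt ?_ (hN m hm n hn)⟩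
    rw [dist_eq_norm, dist_eq_norm, ← map_sub]
    exact hincl _
  obtain ⟨a, ha⟩ := cauchySeq_tendsto_of_complete h1
  obtain ⟨b, hb⟩ := cauchySeq_tendsto_of_complete h2
  have hmem : (b, a) ∈ A.graph := by
    refine (show IsClosed (A.graph : Set (H × H)) from hA).mem_of_tendsto (hb.prodMk_nhds ha)
      (Eventually.of_forall fun n => ?_)
    exact A.mem_graph (x n : A.domain)
  obtain ⟨y, hy1, hy2⟩ := (LinearPMap.mem_graph_iff A).1 hmem
  let y' : GraphDomain A := y
  have e1 : incl A y' = b := hy1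
  have e2 : op A y' = a := hy2
  refine ⟨y', ?_⟩
  rw [tendsto_iff_norm_sub_tendsto_zero] at ha hb ⊢
  have h3 : Tendsto (fun n => Real.sqrt (‖op A (x n) - a‖ ^ 2 + ‖incl A (x n) - b‖ ^ 2)) atTop
      (𝓝 0) := by
    simpa using ((ha.pow 2).add (hb.pow 2)).sqrt
  refine h3.congr fun n => ?_
  rw [← e1, ← e2, ← map_sub, ← map_sub, ← norm_sq_eq, Real.sqrt_sq (norm_nonneg _)]

end GraphDomain

/-- The Hilbert space `𝓗 = D(A) × H`, with inner product
`⟪A u₁, A u₂⟫ + ⟪u₁, u₂⟫ + ⟪v₁, v₂⟫`. -/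
abbrev PhaseSpace (A : H →ₗ.[ℝ] H) : Type _ := WithLp 2 (GraphDomain A × H)

/-- The position component `u ∈ H` of `z = (u, v) ∈ 𝓗`. -/
def pos {A : H →ₗ.[ℝ] H} (z : PhaseSpace A) : H := GraphDomain.incl A z.fst

/-- The velocity component `v ∈ H` of `z = (u, v) ∈ 𝓗`. -/
def vel {A : H →ₗ.[ℝ] H} (z : PhaseSpace A) : H := z.snd

/-- `A u ∈ H` for `z = (u, v) ∈ 𝓗`. -/
def opPos {A : H →ₗ.[ℝ] H} (z : PhaseSpace A) : H := GraphDomain.op A z.fst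

/-- The operator `𝒜 (u, v) = (v, -A² u)` in `𝓗`, with domain `D(A²) × D(A)`, where
`D(A²) = {u ∈ D(A) | A u ∈ D(A)}`. -/
def waveOperator (A : H →ₗ.[ℝ] H) : PhaseSpace A →ₗ.[ℝ] PhaseSpace A where
  domain :=
    { carrier := {z | opPos z ∈ A.domain ∧ vel z ∈ A.domain}
      zero_mem' := by simp [opPos, vel]
      add_mem' := by
        rintro z w ⟨h1, h2⟩ ⟨h3, h4⟩
        exact ⟨by simpa [opPos] using A.domain.add_mem h1 h3,
          by simpa [vel] using A.domain.add_mem h2 h4⟩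
      smul_mem' := by
        rintro c z ⟨h1, h2⟩
        exact ⟨by simpa [opPos] using A.domain.smul_mem c h1,
          by simpa [vel] using A.domain.smul_mem c h2⟩ }
  toFun :=
    { toFun := fun z =>
        WithLp.toLp 2 ((⟨vel z.1, z.2.2⟩ : A.domain), -A ⟨opPos z.1, z.2.1⟩)
      map_add' := by
        rintro ⟨z, h1, h2⟩ ⟨w, h3, h4⟩
        have key : A ⟨opPos (z + w), by simpa [opPos] using A.domain.add_mem h1 h3⟩
            = A ⟨opPos z, h1⟩ + A ⟨opPos w, h3⟩ := by
          rw [← LinearPMap.map_add]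
          congr 1
          exact Subtype.ext (by simp [opPos])
        refine (WithLp.equiv 2 _).injective (Prod.ext rfl ?_)
        change -A ⟨opPos (z + w), _⟩ = -A ⟨opPos z, h1⟩ + -A ⟨opPos w, h3⟩
        rw [key, neg_add]
      map_smul' := by
        rintro c ⟨z, h1, h2⟩
        have key : A ⟨opPos (c • z), by simpa [opPos] using A.domain.smul_mem c h1⟩
            = c • A ⟨opPos z, h1⟩ := by
          rw [← LinearPMap.map_smul]
          congr 1
          exact Subtype.ext (by simp [opPos])
        refine (WithLp.equiv 2 _).injective (Prod.ext rfl ?_)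
        change -A ⟨opPos (c • z), _⟩ = c • -A ⟨opPos z, h1⟩
        rw [key, smul_neg] }

end Domain

section Group

variable {X : Type*} [NormedAddCommGroup X] [NormedSpace ℝ X]

/-- A `C₀` group (strongly continuous one-parameter group) of bounded operators on `X`. -/
structure IsC0Group (S : ℝ → X →L[ℝ] X) : Prop where
  map_zero : S 0 = ContinuousLinearMap.id ℝ X
  map_add : ∀ s t : ℝ, S (s + t) = (S s).comp (S t)
  strongly_continuous : ∀ x : X, Continuous fun t => S t x

/-- `S` is a `C₀` group whose infinitesimal generator is exactly `G`: the domain of `G` consists of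
those `x` for which `lim_{h → 0} (S(h) x - x) / h` exists, and `G x` is that limit. -/
structure IsC0GroupGeneratedBy (S : ℝ → X →L[ℝ] X) (G : X →ₗ.[ℝ] X) : Prop where
  isC0Group : IsC0Group S
  mem_graph_iff : ∀ x y : X,
    (x, y) ∈ G.graph ↔ Tendsto (fun h : ℝ => h⁻¹ • (S h x - x)) (𝓝[≠] 0) (𝓝 y)

end Group

section Equation

variable {H : Type*} [NormedAddCommGroup H] [InnerProductSpace ℝ H]

/-- `A` is a non-negative self-adjoint (possibly unbounded, densely defined) operator on `H`. -/
structure IsNonnegSelfAdjoint [CompleteSpace H] (A : H →ₗ.[ℝ] H) : Prop where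
  isSelfAdjoint : IsSelfAdjoint A
  nonneg : ∀ u : A.domain, 0 ≤ ⟪A u, (u : H)⟫_ℝ

/-- `f ∈ L²_loc([0, ∞); H)`. -/
def MemL2Loc (f : ℝ → H) : Prop :=
  ∀ T : ℝ, 0 < T → MemLp f 2 (volume.restrict (Icc 0 T))

/-- `Π_a x = x - ⟪x, a⟫ a`; for `‖a‖ = 1` the orthogonal projection of `H` onto the tangent space
of the unit sphere at `a`. -/
def tangentProj (a x : H) : H := x - ⟪x, a⟫_ℝ • a

variable {A : H →ₗ.[ℝ] H}

/-- The element `(0, -‖v‖² u + ‖A u‖² u - γ v + Π_u g)` of `𝓗`, for `z = (u, v) ∈ 𝓗` and `g ∈ H`. -/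
def nonlinearity (γ : ℝ) (z : PhaseSpace A) (g : H) : PhaseSpace A :=
  WithLp.toLp 2 (0, -(‖vel z‖ ^ 2 • pos z) + ‖opPos z‖ ^ 2 • pos z - γ • vel z
    + tangentProj (pos z) g)

/-- `z = (u, v) : [0, ∞) → 𝓗` is a mild solution, with initial datum `z₀`, of
`u_tt + ‖u_t‖² u = -A² u + ‖A u‖² u - γ u_t + Π_u f`, with `v = u_t`: the Duhamel formula
holds with the `C₀` group on `𝓗` generated by `𝒜 (u, v) = (v, -A² u)`. -/
def IsMildSolution (γ : ℝ) (f : ℝ → H) (z₀ : PhaseSpace A) (z : ℝ → PhaseSpace A) : Prop :=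
  ∃ S : ℝ → PhaseSpace A →L[ℝ] PhaseSpace A, IsC0GroupGeneratedBy S (waveOperator A) ∧
    ∀ t : ℝ, 0 ≤ t →
      IntervalIntegrable (fun s => S (t - s) (nonlinearity γ (z s) (f s))) volume 0 t ∧
      z t = S t z₀ + ∫ s in (0 : ℝ)..t, S (t - s) (nonlinearity γ (z s) (f s))

/-- The requirements on the solution `z = (u, v)`: it lies in `C([0, ∞); 𝓗)`, `u` is a `C¹` curve
on the unit sphere `M` of `H` with `u_t = v` (one-sided derivative at `t = 0`), and `z` is a mild
solution. Only the values of `z` on `[0, ∞)` matter. -/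
structure IsSolution (γ : ℝ) (f : ℝ → H) (z₀ : PhaseSpace A) (z : ℝ → PhaseSpace A) : Prop where
  continuousOn : ContinuousOn z (Ici 0)
  contDiffOn_pos : ContDiffOn ℝ 1 (fun t => pos (z t)) (Ici 0)
  pos_mem_sphere : ∀ t : ℝ, 0 ≤ t → pos (z t) ∈ Metric.sphere (0 : H) 1
  hasDeriv_pos : ∀ t : ℝ, 0 ≤ t →
    HasDerivWithinAt (fun s => pos (z s)) (vel (z t)) (Ici 0) t
  isMildSolution : IsMildSolution γ f z₀ z

/-- The energy `Ψ(u, v) = (‖A u‖² + ‖v‖²) / 2`. -/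
def energy (z : PhaseSpace A) : ℝ := (1 / 2) * (‖opPos z‖ ^ 2 + ‖vel z‖ ^ 2)

end Equation

end ConstrainedWave

end

noncomputable section

namespace ConstrainedWave

/-! ### Strongly continuous groups and their generators -/

section GroupTheory

variable {X : Type*} [NormedAddCommGroup X] [NormedSpace ℝ X]

/-! Since `S` is a group, the Duhamel formula can be written `z(t) = S(t) (z₀ + ∫₀ᵗ S(-s) F(s) ds)`,
with `F` the nonlinearity along `z`. The only unbounded object is then the group, and `F` is
Lipschitz on bounded sets of the phase space with a constant affine in `‖f(s)‖`, hence locally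
integrable in time. Uniqueness is Grönwall with an integrable kernel (`IsMildOn.eqOn`). For
existence, `F` is composed with a retraction onto a ball of radius `r`. The resulting globally
Lipschitz equation is solved by contraction in an exponentially weighted norm
(`exists_integral_equation`), and an a priori bound shows that the ball is never left.

The a priori bound comes from a chain rule for mild solutions (`chain_rule`). If `Q` is `C¹` and its
derivative along the generator extends from the domain to a continuous `q`, then `Q(z(t)) - Q(z₀)`
is the integral of `q(z) + Q'(z) F`. With `a = ‖u‖² - 1` and `b = ⟪u, v⟫` it gives the linear
homogeneous system `a' = 2 b`, `b' = (‖A u‖² - ‖v‖² - ⟪f, u⟫) a - γ b`, so `a` and `b` stay zero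
(`IsMildOn.constraint`). The free group conserves the energy, and `⟪u, v⟫ = 0` kills the normal
terms in `⟪v, F⟫`. What remains is the energy balance, which bounds `‖z‖² = 2 Ψ(z) + 1` in terms of
`Ψ(z₀)` and the `L¹` norm of `f`.

Both the group and the chain rule rest on the resolvents `J = (1 + ε A²)⁻¹`, obtained by
Lax–Milgram. They supply commuting regularisations of the phase space with values in the domain of
the generator; the exponentials of the regularised generators converge to the group. -/

theorem IsC0Group.apply_add {S : ℝ → X →L[ℝ] X} (hS : IsC0Group S) (s t : ℝ) (x : X) :
    S (s + t) x = S s (S t x) := by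
  rw [hS.map_add]; rfl

theorem IsC0Group.apply_zero {S : ℝ → X →L[ℝ] X} (hS : IsC0Group S) (x : X) : S 0 x = x := by
  rw [hS.map_zero]; rfl

theorem IsC0Group.apply_neg_apply {S : ℝ → X →L[ℝ] X} (hS : IsC0Group S) (t : ℝ) (x : X) :
    S t (S (-t) x) = x := by
  rw [← hS.apply_add, add_neg_cancel, hS.apply_zero]

/-- Orbits are bounded on compact time intervals; uniform boundedness makes this a bound on the
operators. -/
theorem IsC0Group.exists_bound [CompleteSpace X] {S : ℝ → X →L[ℝ] X} (hS : IsC0Group S) (T : ℝ) :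
    ∃ C : ℝ, 0 ≤ C ∧ ∀ t ∈ Icc (-T) T, ‖S t‖ ≤ C := by
  obtain ⟨C, hC⟩ := banach_steinhaus (g := fun t : Icc (-T) T => S t) fun x => by
    obtain ⟨C, hC⟩ := (isCompact_Icc (a := -T) (b := T)).exists_bound_of_continuousOn
      (hS.strongly_continuous x).continuousOn
    exact ⟨C, fun t => hC t t.2⟩
  exact ⟨max C 0, le_max_right _ _, fun t ht => (hC ⟨t, ht⟩).trans (le_max_left _ _)⟩

theorem IsC0Group.continuous_uncurry [CompleteSpace X] {S : ℝ → X →L[ℝ] X} (hS : IsC0Group S) :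
    Continuous fun p : ℝ × X => S p.1 p.2 := by
  rw [continuous_iff_continuousAt]
  rintro ⟨t, x⟩
  obtain ⟨C, -, hC⟩ := hS.exists_bound (|t| + 1)
  have h1 : Tendsto (fun p : ℝ × X => S p.1 x) (𝓝 (t, x)) (𝓝 (S t x)) :=
    ((hS.strongly_continuous x).comp continuous_fst).tendsto (t, x)
  have h2 : Tendsto (fun p : ℝ × X => S p.1 (p.2 - x)) (𝓝 (t, x)) (𝓝 0) := by
    have h3 : Tendsto (fun p : ℝ × X => C * ‖p.2 - x‖) (𝓝 (t, x)) (𝓝 0) := by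
      have : Continuous fun p : ℝ × X => C * ‖p.2 - x‖ := by fun_prop
      simpa using this.tendsto (t, x)
    refine squeeze_zero_norm' ?_ h3
    have h4 : ∀ᶠ p : ℝ × X in 𝓝 (t, x), p.1 ∈ Ioo (t - 1) (t + 1) :=
      continuous_fst.continuousAt.eventually_mem (Ioo_mem_nhds (by simp) (by simp))
    filter_upwards [h4] with p hp
    refine (S p.1).le_of_opNorm_le (hC _ ⟨?_, ?_⟩) _
    · linarith [neg_abs_le t, hp.1]
    · linarith [le_abs_self t, hp.2]
  have := h2.add h1
  simpa [ContinuousAt] using this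

theorem IsC0Group.continuous_apply [CompleteSpace X] {S : ℝ → X →L[ℝ] X} (hS : IsC0Group S)
    {Y : Type*} [TopologicalSpace Y] {a : Y → ℝ} {x : Y → X} (ha : Continuous a)
    (hx : Continuous x) : Continuous fun y => S (a y) (x y) :=
  hS.continuous_uncurry.comp (ha.prodMk hx)

variable {G : X →ₗ.[ℝ] X}

theorem IsC0GroupGeneratedBy.mem_graph_iff_hasDerivAt {S : ℝ → X →L[ℝ] X}
    (hS : IsC0GroupGeneratedBy S G) (x y : X) :
    (x, y) ∈ G.graph ↔ HasDerivAt (fun t => S t x) y 0 := by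
  rw [hS.mem_graph_iff, hasDerivAt_iff_tendsto_slope_zero]
  simp [hS.isC0Group.apply_zero]

theorem IsC0GroupGeneratedBy.apply_mem_graph {S : ℝ → X →L[ℝ] X}
    (hS : IsC0GroupGeneratedBy S G) {x y : X} (h : (x, y) ∈ G.graph) (t : ℝ) :
    (S t x, S t y) ∈ G.graph := by
  rw [hS.mem_graph_iff_hasDerivAt] at h ⊢
  have := (S t).hasFDerivAt.comp_hasDerivAt 0 h
  refine this.congr_of_eventuallyEq (Eventually.of_forall fun r => ?_)
  simp only [Function.comp, ← hS.isC0Group.apply_add, add_comm]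

theorem IsC0GroupGeneratedBy.hasDerivAt {S : ℝ → X →L[ℝ] X}
    (hS : IsC0GroupGeneratedBy S G) {x y : X} (h : (x, y) ∈ G.graph) (t : ℝ) :
    HasDerivAt (fun r => S r x) (S t y) t := by
  have h1 := (hS.mem_graph_iff_hasDerivAt _ _).1 (hS.apply_mem_graph h t)
  have h2 : HasDerivAt (fun r : ℝ => S (r - t) (S t x)) (S t y) t :=
    HasDerivAt.comp_sub_const t t (by simpa using h1)
  simpa [← hS.isC0Group.apply_add] using h2

/-- The difference quotient splits into `S r` applied to the slope of `x` plus the slope of `S · (x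
t)`. Joint continuity handles the first term, so only the value at `t` has to lie in the domain. -/
theorem IsC0GroupGeneratedBy.hasDerivAt_apply [CompleteSpace X] {S : ℝ → X →L[ℝ] X}
    (hS : IsC0GroupGeneratedBy S G) {x : ℝ → X} {x' y : X} {t : ℝ} (hx : HasDerivAt x x' t)
    (h : (x t, y) ∈ G.graph) :
    HasDerivAt (fun r => S r (x r)) (S t y + S t x') t := by
  have h1 := hasDerivAt_iff_tendsto_slope.1 (hS.hasDerivAt h t)
  have h2 := hasDerivAt_iff_tendsto_slope.1 hx
  rw [hasDerivAt_iff_tendsto_slope]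
  have h3 : Tendsto (fun r => S r (slope x t r)) (𝓝[≠] t) (𝓝 (S t x')) :=
    (hS.isC0Group.continuous_uncurry.tendsto (t, x')).comp
      ((tendsto_id'.2 nhdsWithin_le_nhds).prodMk_nhds h2)
  refine (h1.add h3).congr fun r => ?_
  simp only [slope, vsub_eq_sub, map_smul, map_sub, ← smul_add]
  congr 1
  abel

/-- On the domain `r ↦ S (t - r) (S' r x)` has zero derivative, and its values at `0` and `t` are `S
t x` and `S' t x`. This matters because a mild solution is defined with some group, not a prescribed
one. -/
theorem IsC0GroupGeneratedBy.eq_of_dense [CompleteSpace X] {S S' : ℝ → X →L[ℝ] X}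
    (hS : IsC0GroupGeneratedBy S G) (hS' : IsC0GroupGeneratedBy S' G)
    (hG : Dense (G.domain : Set X)) : S = S' := by
  funext t
  have key : ∀ x ∈ G.domain, S t x = S' t x := by
    intro x hx
    have hg : (x, G ⟨x, hx⟩) ∈ G.graph := G.mem_graph ⟨x, hx⟩
    have hd : ∀ s : ℝ, HasDerivAt (fun r => S (t - r) (S' r x)) 0 s := by
      intro s
      -- The product rule has `S` at the running time, so differentiate `S ρ (S' (t - ρ) x)` at `ρ =
      -- t - s` and substitute `ρ = t - r` afterwards.
      have h1 : HasDerivAt (fun r : ℝ => S' (t - r) x) (-(S' (t - (t - s)) (G ⟨x, hx⟩))) (t - s) :=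
        HasDerivAt.comp_const_sub t (t - s) (hS'.hasDerivAt hg _)
      have h2 := hS.hasDerivAt_apply h1 (hS'.apply_mem_graph hg (t - (t - s)))
      simp only [map_neg, add_neg_cancel] at h2
      have h3 := HasDerivAt.comp_const_sub t s h2
      simpa using h3
    have hconst := is_const_of_deriv_eq_zero (fun s => (hd s).differentiableAt)
      (fun s => (hd s).deriv) 0 t
    simpa [hS.isC0Group.apply_zero, hS'.isC0Group.apply_zero] using hconst
  ext x
  exact congrFun (Continuous.ext_on hG (S t).continuous (S' t).continuous key) x

end GroupTheory

/-! ### Generation of groups from bounded regularisations -/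

section Generation

variable {X : Type*} [NormedAddCommGroup X] [NormedSpace ℝ X]

/-- The uniformly continuous group `t ↦ exp (t B)`. -/
def expGroup (B : X →L[ℝ] X) (t : ℝ) : X →L[ℝ] X := NormedSpace.exp (t • B)

theorem expGroup_zero (B : X →L[ℝ] X) : expGroup B 0 = 1 := by
  simp [expGroup]

theorem commute_expGroup {B C : X →L[ℝ] X} (h : Commute C B) (t : ℝ) :
    Commute C (expGroup B t) := by
  have : NormedAlgebra ℚ (X →L[ℝ] X) := NormedAlgebra.restrictScalars ℚ ℝ _
  exact (h.smul_right t).exp_right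

/-- Bounded regularisations `R n → 1` with values in the domain of `G` and with `G ∘ R n` bounded. -/
structure IsRegularization (G : X →ₗ.[ℝ] X) (R Gn : ℕ → X →L[ℝ] X) : Prop where
  mem_graph : ∀ n x, (R n x, Gn n x) ∈ G.graph
  tendsto : ∀ x, Tendsto (fun n => R n x) atTop (𝓝 x)

theorem IsRegularization.dense_domain {G : X →ₗ.[ℝ] X} {R Gn : ℕ → X →L[ℝ] X}
    (h : IsRegularization G R Gn) : Dense (G.domain : Set X) := fun x =>
  mem_closure_of_tendsto (h.tendsto x) (Eventually.of_forall fun n =>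
    LinearPMap.mem_domain_of_mem_graph (h.mem_graph n x))

variable [CompleteSpace X]

theorem expGroup_add (B : X →L[ℝ] X) (s t : ℝ) :
    expGroup B (s + t) = expGroup B s * expGroup B t := by
  have : NormedAlgebra ℚ (X →L[ℝ] X) := NormedAlgebra.restrictScalars ℚ ℝ _
  rw [expGroup, add_smul, NormedSpace.exp_add_of_commute]
  · rfl
  · exact ((Commute.refl B).smul_left s).smul_right t

theorem hasDerivAt_expGroup (B : X →L[ℝ] X) (t : ℝ) :
    HasDerivAt (expGroup B) (expGroup B t * B) t :=
  hasDerivAt_exp_smul_const B t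

theorem continuous_expGroup_apply (B : X →L[ℝ] X) (x : X) : Continuous fun t => expGroup B t x :=
  continuous_iff_continuousAt.2 fun t =>
    ((hasDerivAt_expGroup B t).continuousAt).clm_apply continuousAt_const

theorem hasDerivAt_expGroup_apply (B : X →L[ℝ] X) (x : X) (t : ℝ) :
    HasDerivAt (fun r => expGroup B r x) (expGroup B t (B x)) t := by
  simpa using (hasDerivAt_expGroup B t).clm_apply (hasDerivAt_const t x)

/-- Because `B` and `C` commute, the derivative of `r ↦ exp((t - r) C) exp(r B) x` is the same
product applied to `B x - C x`; the mean value inequality between `0` and `t` concludes. The window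
is doubled because `t - s` ranges over `[-2T, 2T]`. -/
theorem norm_expGroup_sub_le {B C : X →L[ℝ] X} (h : Commute B C) {T K : ℝ} (hT : 0 ≤ T)
    (hB : ∀ t ∈ Icc (-(2 * T)) (2 * T), ‖expGroup B t‖ ≤ K)
    (hC : ∀ t ∈ Icc (-(2 * T)) (2 * T), ‖expGroup C t‖ ≤ K) (x : X) {t : ℝ}
    (ht : t ∈ Icc (-T) T) :
    ‖expGroup B t x - expGroup C t x‖ ≤ K * K * ‖B x - C x‖ * T := by
  have hK : 0 ≤ K := (norm_nonneg _).trans (hB 0 ⟨by linarith, by linarith⟩)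
  have hd : ∀ s ∈ Icc (-T) T, HasDerivWithinAt (fun r => expGroup C (t - r) (expGroup B r x))
      (expGroup C (t - s) (expGroup B s (B x - C x))) (Icc (-T) T) s := by
    intro s _
    have h1 : HasDerivAt (fun r => expGroup C (t - r)) (-(expGroup C (t - s) * C)) s :=
      HasDerivAt.comp_const_sub t s (hasDerivAt_expGroup C (t - s))
    have h2 := h1.clm_apply (hasDerivAt_expGroup_apply B x s)
    refine h2.hasDerivWithinAt.congr_deriv ?_
    have h3 : C (expGroup B s x) = expGroup B s (C x) :=
      DFunLike.congr_fun (commute_expGroup h.symm s).eq x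
    simp only [neg_apply, mul_apply_eq_comp, h3, map_sub]
    abel
  have hbd : ∀ s ∈ Icc (-T) T, ‖expGroup C (t - s) (expGroup B s (B x - C x))‖
      ≤ K * K * ‖B x - C x‖ := by
    intro s hs
    have h1 := (expGroup C (t - s)).le_of_opNorm_le
      (hC _ ⟨by linarith [ht.1, hs.2], by linarith [ht.2, hs.1]⟩) (expGroup B s (B x - C x))
    have h2 := (expGroup B s).le_of_opNorm_le
      (hB s ⟨by linarith [hs.1], by linarith [hs.2]⟩) (B x - C x)
    calc _ ≤ K * ‖expGroup B s (B x - C x)‖ := h1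
      _ ≤ K * (K * ‖B x - C x‖) := by gcongr
      _ = _ := by ring
  have := (convex_Icc (-T) T).norm_image_sub_le_of_norm_hasDerivWithin_le hd hbd
    (⟨by linarith, hT⟩ : (0 : ℝ) ∈ Icc (-T) T) ht
  simp only [sub_self, expGroup_zero, sub_zero, one_apply_eq_self] at this
  refine this.trans ?_
  have h4 : ‖t‖ ≤ T := by rw [Real.norm_eq_abs]; exact abs_le.2 ht
  gcongr

/-- The function `e^{-2cr} ‖exp(r B) x‖²` is nonincreasing. Negative times follow by passing to
`-B`, since the hypothesis is two-sided. -/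
theorem norm_expGroup_le_of_inner {X : Type*} [NormedAddCommGroup X] [InnerProductSpace ℝ X]
    [CompleteSpace X] {B : X →L[ℝ] X} {c : ℝ} (hc : 0 ≤ c)
    (hB : ∀ x, |⟪B x, x⟫_ℝ| ≤ c * ‖x‖ ^ 2) {T t : ℝ} (ht : t ∈ Icc (-T) T) :
    ‖expGroup B t‖ ≤ Real.exp (c * T) := by
  have key : ∀ (B : X →L[ℝ] X), (∀ x, |⟪B x, x⟫_ℝ| ≤ c * ‖x‖ ^ 2) → ∀ t, 0 ≤ t → t ≤ T →
      ‖expGroup B t‖ ≤ Real.exp (c * T) := by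
    intro B hB t h0 htT
    refine ContinuousLinearMap.opNorm_le_bound _ (Real.exp_pos _).le fun x => ?_
    have hd : ∀ s : ℝ, HasDerivAt (fun r => Real.exp (-(2 * c * r)) * ‖expGroup B r x‖ ^ 2)
        (Real.exp (-(2 * c * s)) * (2 * ⟪B (expGroup B s x), expGroup B s x⟫_ℝ
          - 2 * c * ‖expGroup B s x‖ ^ 2)) s := by
      intro s
      have h1 : HasDerivAt (fun r : ℝ => Real.exp (-(2 * c * r)))
          (Real.exp (-(2 * c * s)) * (-(2 * c * 1))) s :=
        (((hasDerivAt_id s).const_mul (2 * c)).neg).exp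
      have h2 := (hasDerivAt_expGroup_apply B x s).norm_sq
      have h3 : expGroup B s (B x) = B (expGroup B s x) :=
        (DFunLike.congr_fun (commute_expGroup (Commute.refl B) s).eq x).symm
      rw [h3, real_inner_comm] at h2
      refine (h1.mul h2).congr_deriv ?_
      ring
    have hanti : Antitone fun r => Real.exp (-(2 * c * r)) * ‖expGroup B r x‖ ^ 2 := by
      refine antitone_of_hasDerivAt_nonpos hd fun s => ?_
      refine mul_nonpos_of_nonneg_of_nonpos (Real.exp_pos _).le ?_
      linarith [(abs_le.1 (hB (expGroup B s x))).2]
    have h5 := hanti h0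
    simp only [mul_zero, neg_zero, Real.exp_zero, one_mul, expGroup_zero,
      one_apply_eq_self] at h5
    have h6 : ‖expGroup B t x‖ ^ 2 ≤ (Real.exp (c * t) * ‖x‖) ^ 2 := by
      have h7 : Real.exp (c * t) ^ 2 * Real.exp (-(2 * c * t)) = 1 := by
        rw [sq, ← Real.exp_add, ← Real.exp_add]; ring_nf; simp
      calc ‖expGroup B t x‖ ^ 2
          = Real.exp (c * t) ^ 2 * (Real.exp (-(2 * c * t)) * ‖expGroup B t x‖ ^ 2) := by
            rw [← mul_assoc, h7, one_mul]
        _ ≤ Real.exp (c * t) ^ 2 * ‖x‖ ^ 2 := by gcongr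
        _ = _ := by ring
    have h8 := abs_le_of_sq_le_sq' h6 (by positivity) |>.2
    refine h8.trans ?_
    gcongr
  rcases le_total 0 t with h | h
  · exact key B hB t h ht.2
  · have := key (-B) (fun x => by simpa using hB x) (-t) (by linarith) (by linarith [ht.1])
    simpa [expGroup] using this

/-- A Trotter–Kato type generation theorem: if a closed operator `G` has commuting bounded
regularisations `R n → 1` whose compositions `Gn n = G ∘ R n` are bounded and generate groups that
are bounded uniformly in `n` on compact time intervals, then `G` generates a `C₀` group. -/
theorem exists_isC0GroupGeneratedBy {G : X →ₗ.[ℝ] X}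
    (hclosed : IsClosed (G.graph : Set (X × X)))
    {R Gn : ℕ → X →L[ℝ] X} (hreg : IsRegularization G R Gn)
    (hGR : ∀ n x y, (x, y) ∈ G.graph → Gn n x = R n y)
    (hRR : ∀ m n, Commute (R m) (R n))
    (hbound : ∀ T : ℝ, ∃ K, ∀ n, ∀ t ∈ Icc (-T) T, ‖expGroup (Gn n) t‖ ≤ K) :
    ∃ S : ℝ → X →L[ℝ] X, IsC0GroupGeneratedBy S G := by
  obtain ⟨hRG, hR⟩ := hreg
  have hfun : ∀ {x y z : X}, (x, y) ∈ G.graph → (x, z) ∈ G.graph → y = z := fun h1 h2 =>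
    G.mem_graph_snd_inj h1 h2 rfl
  have hcross : ∀ m n x, Gn m (R n x) = R m (Gn n x) := fun m n x => hGR m _ _ (hRG n x)
  have hRRx : ∀ m n x, R m (R n x) = R n (R m x) := fun m n x =>
    DFunLike.congr_fun (hRR m n).eq x
  -- Both sides are `G` applied to the same vector `R m (R n x)`.
  have hswap : ∀ m n x, R m (Gn n x) = R n (Gn m x) := by
    intro m n x
    have h1 := hRG m (R n x)
    have h2 := hRG n (R m x)
    rw [hRRx n m, hcross] at h2
    rw [hcross] at h1
    exact hfun h1 h2
  have hcommRG : ∀ m n, Commute (R m) (Gn n) := fun m n => by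
    ext x
    change R m (Gn n x) = Gn n (R m x)
    rw [hcross, hswap]
  have hGG : ∀ m n, Commute (Gn m) (Gn n) := fun m n => by
    ext x
    change Gn m (Gn n x) = Gn n (Gn m x)
    -- Commutation is checked after applying `R k`, where `hcross` and `hswap` apply, and recovered
    -- as `k → ∞`.
    have : ∀ k, R k (Gn m (Gn n x)) = R k (Gn n (Gn m x)) := by
      intro k
      have e : ∀ m n, R k (Gn m (Gn n x)) = Gn k (R m (Gn n x)) := fun m n => by
        rw [hcross]
      rw [e, e, hswap]
    exact tendsto_nhds_unique (hR _) ((hR _).congr fun k => (this k).symm)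
  have hdense : ∀ x : X, ∀ δ : ℝ, 0 < δ → ∃ y z, (y, z) ∈ G.graph ∧ ‖x - y‖ < δ := by
    intro x δ hδ
    obtain ⟨n, hn⟩ := ((Metric.tendsto_nhds.1 (hR x)) δ hδ).exists
    exact ⟨R n x, Gn n x, hRG n x, by rwa [← dist_eq_norm, dist_comm]⟩
  -- Replace `x` by a nearby `y` in the domain, where `Gn n y = R n (G y)` converges. The
  -- replacement costs less than `δ / 4` for each of the two groups, and the difference on `y` at
  -- most `δ / 2`.
  have hcauchy : ∀ x : X, ∀ T : ℝ, 0 ≤ T → ∀ δ : ℝ, 0 < δ → ∃ N, ∀ m ≥ N, ∀ n ≥ N,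
      ∀ t ∈ Icc (-T) T, ‖expGroup (Gn m) t x - expGroup (Gn n) t x‖ < δ := by
    intro x T hT δ hδ
    obtain ⟨K, hK⟩ := hbound (2 * T)
    have hK0 : 0 ≤ K := (norm_nonneg _).trans (hK 0 0 ⟨by linarith, by linarith⟩)
    obtain ⟨y, z, hyz, hxy⟩ := hdense x (δ / (4 * (K + 1))) (by positivity)
    have hC : CauchySeq fun n => Gn n y := by
      have : Tendsto (fun n => Gn n y) atTop (𝓝 z) :=
        (hR z).congr fun n => (hGR n y z hyz).symm
      exact this.cauchySeq
    obtain ⟨N, hN⟩ := Metric.cauchySeq_iff.1 hC (δ / (2 * (K * K * T + 1))) (by positivity)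
    refine ⟨N, fun m hm n hn t ht => ?_⟩
    have ht2 : t ∈ Icc (-(2 * T)) (2 * T) := ⟨by linarith [ht.1], by linarith [ht.2]⟩
    have h1 := norm_expGroup_sub_le (hGG m n) hT (hK m) (hK n) y ht
    have h2 := (hN m hm n hn).le
    rw [dist_eq_norm] at h2
    have h3 : K * K * ‖Gn m y - Gn n y‖ * T ≤ δ / 2 := by
      calc K * K * ‖Gn m y - Gn n y‖ * T ≤ K * K * (δ / (2 * (K * K * T + 1))) * T := by gcongr
        _ = δ / 2 * (K * K * T / (K * K * T + 1)) := by field_simp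
        _ ≤ δ / 2 * 1 := by
            gcongr
            exact div_le_one_of_le₀ (by linarith) (by positivity)
        _ = _ := mul_one _
    have h4 : ∀ k, ‖expGroup (Gn k) t (x - y)‖ < δ / 4 := by
      intro k
      calc _ ≤ K * ‖x - y‖ := (expGroup (Gn k) t).le_of_opNorm_le (hK k t ht2) _
        _ ≤ (K + 1) * ‖x - y‖ := by gcongr; linarith
        _ < (K + 1) * (δ / (4 * (K + 1))) := by gcongr
        _ = _ := by field_simp
    have h5 : expGroup (Gn m) t x - expGroup (Gn n) t x
        = (expGroup (Gn m) t (x - y) - expGroup (Gn n) t (x - y))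
          + (expGroup (Gn m) t y - expGroup (Gn n) t y) := by
      simp only [map_sub]; abel
    rw [h5]
    calc _ ≤ ‖expGroup (Gn m) t (x - y)‖ + ‖expGroup (Gn n) t (x - y)‖
          + ‖expGroup (Gn m) t y - expGroup (Gn n) t y‖ :=
          (norm_add_le _ _).trans (by gcongr; exact norm_sub_le _ _)
      _ < δ := by linarith [h4 m, h4 n]
  have hlim : ∀ t : ℝ, ∀ x, ∃ y, Tendsto (fun n => expGroup (Gn n) t x) atTop (𝓝 y) := by
    intro t x
    refine cauchySeq_tendsto_of_complete (Metric.cauchySeq_iff.2 fun δ hδ => ?_)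
    obtain ⟨N, hN⟩ := hcauchy x |t| (abs_nonneg t) δ hδ
    refine ⟨N, fun m hm n hn => ?_⟩
    rw [dist_eq_norm]
    exact hN m hm n hn t ⟨neg_abs_le t, le_abs_self t⟩
  choose S₀ hS₀ using hlim
  let S : ℝ → X →L[ℝ] X := fun t =>
    continuousLinearMapOfTendsto (f := S₀ t) (fun n => expGroup (Gn n) t)
      (tendsto_pi_nhds.2 fun x => hS₀ t x)
  have hS : ∀ t x, Tendsto (fun n => expGroup (Gn n) t x) atTop (𝓝 (S t x)) := hS₀
  have hunif : ∀ x, TendstoLocallyUniformly (fun n t => expGroup (Gn n) t x) (fun t => S t x)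
      atTop := by
    intro x
    rw [Metric.tendstoLocallyUniformly_iff]
    intro δ hδ t
    obtain ⟨N, hN⟩ := hcauchy x (|t| + 1) (by positivity) (δ / 2) (by positivity)
    refine ⟨Ioo (t - 1) (t + 1), Ioo_mem_nhds (by linarith) (by linarith), ?_⟩
    filter_upwards [eventually_ge_atTop N] with n hn s hs
    have hs' : s ∈ Icc (-(|t| + 1)) (|t| + 1) :=
      ⟨by linarith [neg_abs_le t, hs.1], by linarith [le_abs_self t, hs.2]⟩
    rw [dist_eq_norm]
    refine lt_of_le_of_lt (le_of_tendsto ((hS s x).sub_const (expGroup (Gn n) s x)).norm ?_)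
      (half_lt_self hδ)
    filter_upwards [eventually_ge_atTop N] with m hm
    exact (hN m hm n hn s hs').le
  have hgroup : IsC0Group S := by
    refine ⟨?_, fun s t => ?_, fun x => ?_⟩
    · ext x
      refine tendsto_nhds_unique (hS 0 x) ?_
      simp [expGroup_zero]
    · ext x
      refine tendsto_nhds_unique (hS (s + t) x) ?_
      obtain ⟨K, hK⟩ := hbound |s|
      have h1 : Tendsto (fun n => expGroup (Gn n) s (expGroup (Gn n) t x - S t x)) atTop (𝓝 0) := by
        have h2 : Tendsto (fun n => K * ‖expGroup (Gn n) t x - S t x‖) atTop (𝓝 0) := by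
          simpa using ((tendsto_iff_norm_sub_tendsto_zero.1 (hS t x)).const_mul K)
        exact squeeze_zero_norm (fun n => (expGroup (Gn n) s).le_of_opNorm_le
          (hK n s ⟨neg_abs_le s, le_abs_self s⟩) _) h2
      have h3 := h1.add (hS s (S t x))
      simpa [expGroup_add] using h3
    · exact (hunif x).continuous (Frequently.of_forall fun n => continuous_expGroup_apply _ x)
  -- The derivatives `exp(t Gn) (Gn n x)` converge locally uniformly to `S t y`, so the limit may be
  -- differentiated.
  have hderiv : ∀ x y, (x, y) ∈ G.graph → HasDerivAt (fun t => S t x) y 0 := by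
    intro x y hxy
    have hu : TendstoLocallyUniformlyOn (fun n t => expGroup (Gn n) t (Gn n x))
        (fun t => S t y) atTop (univ : Set ℝ) := by
      rw [tendstoLocallyUniformlyOn_univ, Metric.tendstoLocallyUniformly_iff]
      intro δ hδ t
      obtain ⟨K, hK⟩ := hbound (|t| + 1)
      have hK0 : 0 ≤ K := (norm_nonneg _).trans (hK 0 0 ⟨by linarith [abs_nonneg t], by positivity⟩)
      obtain ⟨U, hU, h1⟩ := Metric.tendstoLocallyUniformly_iff.1 (hunif y) (δ / 2)
        (by positivity) t
      refine ⟨U ∩ Ioo (t - 1) (t + 1), inter_mem hU (Ioo_mem_nhds (by linarith) (by linarith)), ?_⟩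
      have h2 : Tendsto (fun n => Gn n x) atTop (𝓝 y) :=
        (hR y).congr fun n => (hGR n x y hxy).symm
      have h3 := (Metric.tendsto_nhds.1 h2) (δ / (2 * (K + 1))) (by positivity)
      filter_upwards [h1, h3] with n hn1 hn3 s hs
      have hs' : s ∈ Icc (-(|t| + 1)) (|t| + 1) :=
        ⟨by linarith [neg_abs_le t, hs.2.1], by linarith [le_abs_self t, hs.2.2]⟩
      have h4 := hn1 s hs.1
      have h5 : dist (expGroup (Gn n) s y) (expGroup (Gn n) s (Gn n x)) ≤ δ / 2 := by
        rw [dist_comm, dist_eq_norm, ← map_sub]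
        calc _ ≤ K * ‖Gn n x - y‖ := (expGroup (Gn n) s).le_of_opNorm_le (hK n s hs') _
          _ ≤ (K + 1) * (δ / (2 * (K + 1))) := by
            rw [← dist_eq_norm]
            gcongr
            linarith
          _ = _ := by field_simp
      linarith [dist_triangle (S s y) (expGroup (Gn n) s y) (expGroup (Gn n) s (Gn n x))]
    have := hasDerivAt_of_tendstoLocallyUniformlyOn isOpen_univ hu
      (Eventually.of_forall fun n t _ => hasDerivAt_expGroup_apply (Gn n) x t)
      (fun t _ => hS t x) (mem_univ 0)
    simpa [hgroup.apply_zero] using this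
  refine ⟨S, hgroup, fun x y => ?_⟩
  have hiff : HasDerivAt (fun t => S t x) y 0 ↔
      Tendsto (fun h : ℝ => h⁻¹ • (S h x - x)) (𝓝[≠] 0) (𝓝 y) := by
    rw [hasDerivAt_iff_tendsto_slope_zero]
    simp [hgroup.apply_zero]
  rw [← hiff]
  refine ⟨hderiv x y, fun h => ?_⟩
  -- For the converse, `R n` commutes with `S`, so differentiating at `R n x`, which is in the
  -- domain, gives `G (R n x) = R n y`. Closedness of `G` then yields `(x, y)` in the limit.
  have hRS : ∀ n t x, R n (S t x) = S t (R n x) := by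
    intro n t x
    refine tendsto_nhds_unique (((R n).continuous.tendsto _).comp (hS t x)) ?_
    refine (hS t (R n x)).congr fun k => ?_
    exact (DFunLike.congr_fun (commute_expGroup (hcommRG n k) t).eq x).symm
  have hmem : ∀ n, (R n x, R n y) ∈ G.graph := by
    intro n
    have h1 := (R n).hasFDerivAt.comp_hasDerivAt 0 h
    have h2 : HasDerivAt (fun t => S t (R n x)) (R n y) 0 :=
      h1.congr_of_eventuallyEq (Eventually.of_forall fun t => (hRS n t x).symm)
    have h3 := h2.unique (hderiv _ _ (hRG n x))
    rw [h3]
    exact hRG n x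
  exact hclosed.mem_of_tendsto ((hR x).prodMk_nhds (hR y)) (Eventually.of_forall hmem)

end Generation

/-! ### The resolvents `(1 + ε A²)⁻¹` -/

section Resolvent

variable {H : Type*} [NormedAddCommGroup H] [InnerProductSpace ℝ H]

namespace GraphDomain

theorem norm_op_le {A : H →ₗ.[ℝ] H} (u : GraphDomain A) : ‖op A u‖ ≤ ‖u‖ :=
  abs_le_of_sq_le_sq' (by nlinarith [norm_sq_eq A u, sq_nonneg ‖incl A u‖]) (norm_nonneg u) |>.2

theorem norm_incl_le {A : H →ₗ.[ℝ] H} (u : GraphDomain A) : ‖incl A u‖ ≤ ‖u‖ :=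
  abs_le_of_sq_le_sq' (by nlinarith [norm_sq_eq A u, sq_nonneg ‖op A u‖]) (norm_nonneg u) |>.2

/-- The inclusion `D(A) → H` as a bounded operator. -/
def inclL (A : H →ₗ.[ℝ] H) : GraphDomain A →L[ℝ] H :=
  (incl A).mkContinuous 1 fun u => by simpa using norm_incl_le u

/-- The operator `A : D(A) → H` as a bounded operator for the graph norm. -/
def opL (A : H →ₗ.[ℝ] H) : GraphDomain A →L[ℝ] H :=
  (op A).mkContinuous 1 fun u => by simpa using norm_op_le u

variable {A : H →ₗ.[ℝ] H}

theorem exists_incl_eq {x : H} (hx : x ∈ A.domain) : ∃ p : GraphDomain A, incl A p = x :=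
  ⟨(⟨x, hx⟩ : A.domain), rfl⟩

theorem incl_mem (u : GraphDomain A) : incl A u ∈ A.domain := Subtype.property (p := (· ∈ A.domain)) u

theorem apply_mk {x : H} (hx : x ∈ A.domain) {p : GraphDomain A} (hp : incl A p = x) :
    A ⟨x, hx⟩ = op A p := by
  subst hp; rfl

theorem tendsto_of_tendsto {ι : Type*} {l : Filter ι} {x : ι → GraphDomain A} {u : GraphDomain A}
    (h1 : Tendsto (fun n => incl A (x n)) l (𝓝 (incl A u)))
    (h2 : Tendsto (fun n => op A (x n)) l (𝓝 (op A u))) : Tendsto x l (𝓝 u) := by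
  rw [tendsto_iff_norm_sub_tendsto_zero] at h1 h2 ⊢
  have h3 : Tendsto (fun n => Real.sqrt (‖op A (x n) - op A u‖ ^ 2
      + ‖incl A (x n) - incl A u‖ ^ 2)) l (𝓝 0) := by
    simpa using ((h2.pow 2).add (h1.pow 2)).sqrt
  refine h3.congr fun n => ?_
  rw [← map_sub, ← map_sub, ← norm_sq_eq, Real.sqrt_sq (norm_nonneg _)]

end GraphDomain

open GraphDomain

variable [CompleteSpace H] {A : H →ₗ.[ℝ] H}

theorem inner_op_incl (hA : IsSelfAdjoint A) (u w : GraphDomain A) :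
    ⟪op A u, incl A w⟫_ℝ = ⟪incl A u, op A w⟫_ℝ := by
  have h := LinearPMap.adjoint_isFormalAdjoint (T := A) hA.dense_domain
  rw [LinearPMap.isSelfAdjoint_def.1 hA] at h
  exact h u w

/-- The hypothesis says that `x` lies in the domain of the adjoint with image `y`, and the adjoint
is `A`. -/
theorem exists_incl_eq_of_forall_inner (hA : IsSelfAdjoint A) {x y : H}
    (h : ∀ w : GraphDomain A, ⟪y, incl A w⟫_ℝ = ⟪x, op A w⟫_ℝ) :
    ∃ p : GraphDomain A, incl A p = x ∧ op A p = y := by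
  have key : (x, y) ∈ (LinearPMap.adjoint A).graph := by
    have hx : x ∈ (LinearPMap.adjoint A).domain :=
      LinearPMap.mem_adjoint_domain_of_exists x ⟨y, h⟩
    have := LinearPMap.adjoint_apply_eq hA.dense_domain ⟨x, hx⟩ h
    rw [LinearPMap.mem_graph_iff]
    exact ⟨⟨x, hx⟩, rfl, this⟩
  rw [LinearPMap.isSelfAdjoint_def.1 hA, LinearPMap.mem_graph_iff] at key
  exact key

/-- `J : H → D(A)` is the resolvent `(1 + ε A²)⁻¹`. -/
def IsResolvent (A : H →ₗ.[ℝ] H) (ε : ℝ) (J : H →L[ℝ] GraphDomain A) : Prop :=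
  ∀ h, ∃ p, incl A p = op A (J h) ∧ incl A (J h) + ε • op A p = h

/-- Lax–Milgram on `D(A)` for the form `ε ⟪A u, A w⟫ + ⟪u, w⟫`. The weak equation for the solution
`a` says that `A a` is in the domain of the adjoint, so self-adjointness upgrades it to the strong
one. -/
theorem exists_isResolvent (hA : IsSelfAdjoint A) {ε : ℝ} (hε : 0 < ε) :
    ∃ J, IsResolvent A ε J := by
  have : CompleteSpace (GraphDomain A) := GraphDomain.completeSpace A hA.isClosed
  let B : GraphDomain A →L[ℝ] GraphDomain A →L[ℝ] ℝ :=
    ε • (innerSL ℝ).bilinearComp (opL A) (opL A) + (innerSL ℝ).bilinearComp (inclL A) (inclL A)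
  have hB : ∀ u w, B u w = ε * ⟪op A u, op A w⟫_ℝ + ⟪incl A u, incl A w⟫_ℝ := fun u w => rfl
  have hcoer : IsCoercive B := by
    refine ⟨min ε 1, by positivity, fun u => ?_⟩
    rw [hB, real_inner_self_eq_norm_sq, real_inner_self_eq_norm_sq, mul_assoc, ← sq, norm_sq_eq]
    nlinarith [min_le_left ε 1, min_le_right ε 1, sq_nonneg ‖op A u‖, sq_nonneg ‖incl A u‖]
  refine ⟨(hcoer.continuousLinearEquivOfBilin.symm : GraphDomain A →L[ℝ] GraphDomain A).comp
    (ContinuousLinearMap.adjoint (inclL A)), fun h => ?_⟩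
  set a := ((hcoer.continuousLinearEquivOfBilin.symm : GraphDomain A →L[ℝ] GraphDomain A).comp
    (ContinuousLinearMap.adjoint (inclL A))) h with ha
  have h1 : hcoer.continuousLinearEquivOfBilin a = ContinuousLinearMap.adjoint (inclL A) h := by
    simp [ha]
  have h2 : ∀ w, ε * ⟪op A a, op A w⟫_ℝ + ⟪incl A a, incl A w⟫_ℝ = ⟪h, incl A w⟫_ℝ := by
    intro w
    rw [← hB, ← hcoer.continuousLinearEquivOfBilin_apply, h1,
      ContinuousLinearMap.adjoint_inner_left]
    rfl
  obtain ⟨p, hp1, hp2⟩ := exists_incl_eq_of_forall_inner hA (x := op A a)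
    (y := ε⁻¹ • (h - incl A a)) fun w => by
      rw [real_inner_smul_left, inner_sub_left, ← h2 w]
      field_simp
      ring
  refine ⟨p, hp1, ?_⟩
  rw [hp2, smul_inv_smul₀ hε.ne']
  abel

namespace IsResolvent

variable {ε δ : ℝ} {J J' : H →L[ℝ] GraphDomain A}

/-- The difference `d` of two solutions satisfies `d + ε A² d = 0`; pairing with `d` gives `‖d‖² + ε
‖A d‖² = 0`. -/
theorem eq_of_eq (hA : IsSelfAdjoint A) (hε : 0 < ε) (hJ : IsResolvent A ε J)
    {x p : GraphDomain A} {h : H} (h1 : incl A p = op A x) (h2 : incl A x + ε • op A p = h) :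
    J h = x := by
  obtain ⟨q, hq1, hq2⟩ := hJ h
  have e1 : incl A (q - p) = op A (J h - x) := by rw [map_sub, map_sub, hq1, h1]
  have e2 : incl A (J h - x) + ε • op A (q - p) = 0 := by
    rw [map_sub, map_sub, smul_sub]
    calc _ = (incl A (J h) + ε • op A q) - (incl A x + ε • op A p) := by abel
      _ = 0 := by rw [hq2, h2, sub_self]
  have e3 : ⟪incl A (J h - x), incl A (J h - x)⟫_ℝ
      + ε * ⟪op A (J h - x), op A (J h - x)⟫_ℝ = 0 := by
    have := congrArg (fun y => ⟪y, incl A (J h - x)⟫_ℝ) e2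
    simp only [inner_add_left, real_inner_smul_left, inner_zero_left] at this
    rw [inner_op_incl hA, e1] at this
    exact this
  rw [real_inner_self_eq_norm_sq, real_inner_self_eq_norm_sq] at e3
  have e4 : ‖incl A (J h - x)‖ ^ 2 = 0 := by
    nlinarith [sq_nonneg ‖incl A (J h - x)‖, mul_nonneg hε.le (sq_nonneg ‖op A (J h - x)‖)]
  have e5 : incl A (J h - x) = 0 := by simpa using e4
  have e6 : J h - x = 0 := incl_injective A (by rw [e5, map_zero])
  exact sub_eq_zero.1 e6

theorem norm_sq (hA : IsSelfAdjoint A) (hJ : IsResolvent A ε J) (h : H) :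
    ‖incl A (J h)‖ ^ 2 + ε * ‖op A (J h)‖ ^ 2 = ⟪h, incl A (J h)⟫_ℝ := by
  obtain ⟨q, hq1, hq2⟩ := hJ h
  have h1 := congrArg (fun y => ⟪y, incl A (J h)⟫_ℝ) hq2
  simp only [inner_add_left, real_inner_smul_left] at h1
  rw [inner_op_incl hA, hq1, real_inner_self_eq_norm_sq, real_inner_self_eq_norm_sq] at h1
  exact h1

theorem norm_incl_le (hA : IsSelfAdjoint A) (hε : 0 < ε) (hJ : IsResolvent A ε J) (h : H) :
    ‖incl A (J h)‖ ≤ ‖h‖ := by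
  have h1 := hJ.norm_sq hA h
  have h2 := real_inner_le_norm h (incl A (J h))
  have h3 : 0 ≤ ε * ‖op A (J h)‖ ^ 2 := by positivity
  by_contra! h4
  nlinarith [norm_nonneg h]

theorem norm_op_sq_le (hA : IsSelfAdjoint A) (hε : 0 < ε) (hJ : IsResolvent A ε J) (h : H) :
    ε * ‖op A (J h)‖ ^ 2 ≤ ‖h‖ ^ 2 := by
  have h1 := hJ.norm_sq hA h
  have h2 := real_inner_le_norm h (incl A (J h))
  have h3 := hJ.norm_incl_le hA hε h
  nlinarith [norm_nonneg h, sq_nonneg ‖incl A (J h)‖]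

/-- `A` commutes with the resolvent: `A² J x = ε⁻¹ (x - J x)` is in the domain, so `A J x` solves
the resolvent equation with right-hand side `A x`. -/
theorem op_incl (hA : IsSelfAdjoint A) (hε : 0 < ε) (hJ : IsResolvent A ε J)
    (x : GraphDomain A) : op A (J (incl A x)) = incl A (J (op A x)) := by
  obtain ⟨p, hp1, hp2⟩ := hJ (incl A x)
  have h1 : op A p = ε⁻¹ • (incl A x - incl A (J (incl A x))) := by
    rw [eq_inv_smul_iff₀ hε.ne', eq_sub_iff_add_eq', hp2]
  have h2 : J (op A x) = p := by
    refine hJ.eq_of_eq hA hε (p := ε⁻¹ • (x - J (incl A x))) ?_ ?_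
    · rw [h1, map_smul, map_sub]
    · rw [map_smul, map_sub, smul_inv_smul₀ hε.ne', hp1]
      abel
  rw [h2, hp1]

theorem incl_comm (hA : IsSelfAdjoint A) (hε : 0 < ε) (hδ : 0 < δ) (hJ : IsResolvent A ε J)
    (hJ' : IsResolvent A δ J') (h : H) : J (incl A (J' h)) = J' (incl A (J h)) := by
  obtain ⟨p, hp1, hp2⟩ := hJ' h
  refine (hJ'.eq_of_eq hA hδ (p := J (incl A p)) ?_ ?_).symm
  · rw [hp1, hJ.op_incl hA hε]
  · rw [hJ.op_incl hA hε, ← map_smul, ← map_add, ← map_smul, ← map_add, hp2]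

theorem inner_op (hA : IsSelfAdjoint A) (hJ : IsResolvent A ε J) (h k : H) :
    ⟪op A (J h), k⟫_ℝ = ⟪h, op A (J k)⟫_ℝ := by
  obtain ⟨q, hq1, hq2⟩ := hJ h
  obtain ⟨p, hp1, hp2⟩ := hJ k
  conv_lhs => rw [← hp2]
  conv_rhs => rw [← hq2]
  rw [inner_add_right, inner_add_left, real_inner_smul_left, real_inner_smul_right,
    inner_op_incl hA, ← hq1, ← inner_op_incl hA q p, hp1]

/-- Here `J x - x = -ε A J A x`, and `A J` has norm at most `ε^{-1/2}`: convergence at rate `√ε` on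
`D(A)`. Contractivity and density extend the convergence, without rate, to all of `H`. -/
theorem norm_sub_sq_le (hA : IsSelfAdjoint A) (hε : 0 < ε) (hJ : IsResolvent A ε J)
    (x : GraphDomain A) :
    ‖incl A (J (incl A x)) - incl A x‖ ^ 2 ≤ ε * ‖op A x‖ ^ 2 := by
  obtain ⟨p, hp1, hp2⟩ := hJ (incl A x)
  have h1 : p = J (op A x) := incl_injective A (by rw [hp1, hJ.op_incl hA hε])
  have h2 : incl A (J (incl A x)) - incl A x = -(ε • op A p) := by
    rw [eq_neg_iff_add_eq_zero, sub_add_eq_add_sub, hp2, sub_self]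
  rw [h2, norm_neg, norm_smul, mul_pow, Real.norm_eq_abs, sq_abs, h1]
  have := hJ.norm_op_sq_le hA hε (op A x)
  nlinarith

theorem tendsto_incl (hA : IsSelfAdjoint A) {ε : ℕ → ℝ} (hε : ∀ n, 0 < ε n)
    (hε0 : Tendsto ε atTop (𝓝 0)) {J : ℕ → H →L[ℝ] GraphDomain A}
    (hJ : ∀ n, IsResolvent A (ε n) (J n)) (h : H) :
    Tendsto (fun n => incl A (J n h)) atTop (𝓝 h) := by
  have hdom : ∀ x : GraphDomain A, Tendsto (fun n => incl A (J n (incl A x))) atTop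
      (𝓝 (incl A x)) := by
    intro x
    rw [tendsto_iff_norm_sub_tendsto_zero]
    have h1 : Tendsto (fun n => Real.sqrt (ε n * ‖op A x‖ ^ 2)) atTop (𝓝 0) := by
      simpa only [zero_mul, Real.sqrt_zero] using (hε0.mul_const (‖op A x‖ ^ 2)).sqrt
    refine squeeze_zero (fun n => norm_nonneg _) (fun n => ?_) h1
    exact Real.le_sqrt_of_sq_le ((hJ n).norm_sub_sq_le hA (hε n) x)
  rw [Metric.tendsto_atTop]
  intro r hr
  obtain ⟨y, hy, hxy⟩ := Metric.dense_iff.1 hA.dense_domain h (r / 3) (by positivity)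
  obtain ⟨x, rfl⟩ := GraphDomain.exists_incl_eq hxy
  obtain ⟨N, hN⟩ := Metric.tendsto_atTop.1 (hdom x) (r / 3) (by positivity)
  refine ⟨N, fun n hn => ?_⟩
  have h1 := hN n hn
  rw [Metric.mem_ball] at hy
  have h2 : dist (incl A (J n h)) (incl A (J n (incl A x))) ≤ dist (incl A x) h := by
    rw [dist_eq_norm, ← map_sub, ← map_sub, dist_comm, dist_eq_norm]
    exact (hJ n).norm_incl_le hA (hε n) _
  linarith [dist_triangle (incl A (J n h)) (incl A (J n (incl A x))) h,
    dist_triangle (incl A (J n (incl A x))) (incl A x) h]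

end IsResolvent

end Resolvent

/-! ### The wave group on the phase space -/

section Wave

open GraphDomain

variable {H : Type*} [NormedAddCommGroup H] [InnerProductSpace ℝ H] {A : H →ₗ.[ℝ] H}

/-- The position component as a bounded operator. -/
def posL (A : H →ₗ.[ℝ] H) : PhaseSpace A →L[ℝ] H := (inclL A).comp (WithLp.fstL 2 ℝ _ _)

/-- The velocity component as a bounded operator. -/
def velL (A : H →ₗ.[ℝ] H) : PhaseSpace A →L[ℝ] H := WithLp.sndL 2 ℝ _ _

/-- The operator `(u, v) ↦ A u` as a bounded operator. -/
def opPosL (A : H →ₗ.[ℝ] H) : PhaseSpace A →L[ℝ] H := (opL A).comp (WithLp.fstL 2 ℝ _ _)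

theorem posL_apply (z : PhaseSpace A) : posL A z = pos z := rfl

theorem velL_apply (z : PhaseSpace A) : velL A z = vel z := rfl

theorem opPosL_apply (z : PhaseSpace A) : opPosL A z = opPos z := rfl

theorem phase_norm_sq (z : PhaseSpace A) :
    ‖z‖ ^ 2 = ‖opPos z‖ ^ 2 + ‖pos z‖ ^ 2 + ‖vel z‖ ^ 2 := by
  rw [WithLp.prod_norm_sq_eq_of_L2, GraphDomain.norm_sq_eq]; rfl

theorem mem_graph_waveOperator (z y : PhaseSpace A) :
    (z, y) ∈ (waveOperator A).graph ↔
      pos y = vel z ∧ ∃ p : GraphDomain A, incl A p = opPos z ∧ vel y = -op A p := by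
  rw [LinearPMap.mem_graph_iff]
  constructor
  · rintro ⟨⟨x, hx1, hx2⟩, h1, h2⟩
    subst h1
    subst h2
    exact ⟨rfl, (⟨opPos x, hx1⟩ : A.domain), rfl, rfl⟩
  · rintro ⟨h1, p, hp1, hp2⟩
    refine ⟨⟨z, ?_, ?_⟩, rfl, ?_⟩
    · rw [← hp1]; exact incl_mem p
    · rw [← h1]; exact incl_mem y.fst
    · refine (WithLp.equiv 2 _).injective (Prod.ext ?_ ?_)
      · exact incl_injective A h1.symm
      · change -A ⟨opPos z, _⟩ = vel y
        rw [hp2, apply_mk _ hp1]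

theorem tendsto_phase {ι : Type*} {l : Filter ι} {x : ι → PhaseSpace A} {z : PhaseSpace A}
    (h1 : Tendsto (fun n => pos (x n)) l (𝓝 (pos z)))
    (h2 : Tendsto (fun n => opPos (x n)) l (𝓝 (opPos z)))
    (h3 : Tendsto (fun n => vel (x n)) l (𝓝 (vel z))) : Tendsto x l (𝓝 z) :=
  ((WithLp.prod_continuous_toLp 2 (GraphDomain A) H).tendsto (z.fst, z.snd)).comp
    ((GraphDomain.tendsto_of_tendsto h1 h2).prodMk_nhds h3)

theorem isClosed_graph_waveOperator (hA : A.IsClosed) :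
    IsClosed ((waveOperator A).graph : Set (PhaseSpace A × PhaseSpace A)) := by
  have hAc : IsClosed (A.graph : Set (H × H)) := hA
  have h : ((waveOperator A).graph : Set (PhaseSpace A × PhaseSpace A)) =
      {q | posL A q.2 = velL A q.1} ∩ {q | (opPosL A q.1, -velL A q.2) ∈ (A.graph : Set (H × H))} := by
    ext ⟨z, y⟩
    rw [SetLike.mem_coe, mem_graph_waveOperator]
    change _ ↔ pos y = vel z ∧ (opPos z, -vel y) ∈ A.graph
    rw [LinearPMap.mem_graph_iff]
    refine and_congr_right fun _ => ⟨?_, ?_⟩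
    · rintro ⟨p, hp1, hp2⟩
      exact ⟨p, hp1, by rw [hp2, neg_neg]; rfl⟩
    · rintro ⟨p, hp1, hp2⟩
      exact ⟨p, hp1, (neg_eq_iff_eq_neg.2 hp2).symm⟩
  rw [h]
  exact (isClosed_eq (by fun_prop) (by fun_prop)).inter (hAc.preimage (by fun_prop))

/-- The diagonal regularisation `(u, v) ↦ (J u, J v)` of the phase space. -/
def phaseReg (J : H →L[ℝ] GraphDomain A) : PhaseSpace A →L[ℝ] PhaseSpace A :=
  ((WithLp.prodContinuousLinearEquiv 2 ℝ (GraphDomain A) H).symm :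
    GraphDomain A × H →L[ℝ] PhaseSpace A).comp
    ((J.comp (posL A)).prod ((inclL A).comp (J.comp (velL A))))

/-- The bounded operator `(u, v) ↦ (J v, -ε⁻¹ (u - J u))`, which is `𝒜 (J u, J v)` when
`J = (1 + ε A²)⁻¹`. -/
def phaseYosida (ε : ℝ) (J : H →L[ℝ] GraphDomain A) : PhaseSpace A →L[ℝ] PhaseSpace A :=
  ((WithLp.prodContinuousLinearEquiv 2 ℝ (GraphDomain A) H).symm :
    GraphDomain A × H →L[ℝ] PhaseSpace A).comp
    ((J.comp (velL A)).prod (-(ε⁻¹ • (posL A - (inclL A).comp (J.comp (posL A))))))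

theorem phase_ext {z w : PhaseSpace A} (h1 : pos z = pos w) (h2 : vel z = vel w) : z = w :=
  (WithLp.equiv 2 _).injective (Prod.ext (incl_injective A h1) h2)

theorem pos_phaseReg (J : H →L[ℝ] GraphDomain A) (z : PhaseSpace A) :
    pos (phaseReg J z) = incl A (J (pos z)) := rfl

theorem vel_phaseReg (J : H →L[ℝ] GraphDomain A) (z : PhaseSpace A) :
    vel (phaseReg J z) = incl A (J (vel z)) := rfl

theorem pos_phaseYosida (ε : ℝ) (J : H →L[ℝ] GraphDomain A) (z : PhaseSpace A) :
    pos (phaseYosida ε J z) = incl A (J (vel z)) := rfl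

theorem vel_phaseYosida (ε : ℝ) (J : H →L[ℝ] GraphDomain A) (z : PhaseSpace A) :
    vel (phaseYosida ε J z) = -(ε⁻¹ • (pos z - incl A (J (pos z)))) := rfl

namespace IsResolvent

variable {ε : ℝ} {J : H →L[ℝ] GraphDomain A}

theorem mem_graph (hε : 0 < ε) (hJ : IsResolvent A ε J) (z : PhaseSpace A) :
    (phaseReg J z, phaseYosida ε J z) ∈ (waveOperator A).graph := by
  rw [mem_graph_waveOperator]
  obtain ⟨p, hp1, hp2⟩ := hJ (pos z)
  refine ⟨rfl, p, hp1, ?_⟩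
  rw [vel_phaseYosida]
  congr 1
  rw [inv_smul_eq_iff₀ hε.ne', sub_eq_iff_eq_add', hp2]

variable [CompleteSpace H]

theorem phaseYosida_eq (hA : IsSelfAdjoint A) (hε : 0 < ε) (hJ : IsResolvent A ε J)
    {z y : PhaseSpace A} (h : (z, y) ∈ (waveOperator A).graph) :
    phaseYosida ε J z = phaseReg J y := by
  obtain ⟨h1, p, hp1, hp2⟩ := (mem_graph_waveOperator z y).1 h
  refine phase_ext ?_ ?_
  · rw [pos_phaseYosida, pos_phaseReg, h1]
  · rw [vel_phaseYosida, vel_phaseReg, hp2, map_neg, map_neg]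
    congr 1
    obtain ⟨q, hq1, hq2⟩ := hJ (pos z)
    have h2 : q = J (opPos z) := incl_injective A (by
      rw [hq1]; exact hJ.op_incl hA hε z.fst)
    rw [inv_smul_eq_iff₀ hε.ne', sub_eq_iff_eq_add', ← hJ.op_incl hA hε, hp1, ← h2, hq2]

/-- By symmetry of `A J` the terms `⟪A J v, A u⟫` and `-⟪A J A u, v⟫` cancel. Only `⟪J v, u⟫`
survives, from the `‖u‖²` part of the norm, and its bound is uniform in `ε`. -/
theorem abs_inner_phaseYosida_le (hA : IsSelfAdjoint A) (hε : 0 < ε) (hJ : IsResolvent A ε J)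
    (z : PhaseSpace A) : |⟪phaseYosida ε J z, z⟫_ℝ| ≤ 1 * ‖z‖ ^ 2 := by
  obtain ⟨q, hq1, hq2⟩ := hJ (pos z)
  have h2 : q = J (opPos z) := incl_injective A (by
    rw [hq1]; exact hJ.op_incl hA hε z.fst)
  have h3 : vel (phaseYosida ε J z) = -op A (J (opPos z)) := by
    rw [vel_phaseYosida, ← h2]
    congr 1
    rw [inv_smul_eq_iff₀ hε.ne', sub_eq_iff_eq_add', hq2]
  have h4 : ⟪phaseYosida ε J z, z⟫_ℝ = ⟪op A (J (vel z)), opPos z⟫_ℝ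
      + ⟪incl A (J (vel z)), pos z⟫_ℝ + ⟪vel (phaseYosida ε J z), vel z⟫_ℝ := rfl
  have h5 : ⟪phaseYosida ε J z, z⟫_ℝ = ⟪incl A (J (vel z)), pos z⟫_ℝ := by
    rw [h4, h3, inner_neg_left, hJ.inner_op hA, real_inner_comm (op A (J (opPos z)))]
    ring
  rw [h5]
  calc _ ≤ ‖incl A (J (vel z))‖ * ‖pos z‖ := abs_real_inner_le_norm _ _
    _ ≤ ‖vel z‖ * ‖pos z‖ := by gcongr; exact hJ.norm_incl_le hA hε _
    _ ≤ 1 * ‖z‖ ^ 2 := by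
      rw [phase_norm_sq]
      nlinarith [sq_nonneg (‖vel z‖ - ‖pos z‖), sq_nonneg ‖opPos z‖, sq_nonneg (‖vel z‖),
        sq_nonneg (‖pos z‖)]

end IsResolvent

variable [CompleteSpace H]

theorem exists_regularization_and_group (hA : IsSelfAdjoint A) :
    (∃ R Gn, IsRegularization (waveOperator A) R Gn) ∧
      ∃ S, IsC0GroupGeneratedBy S (waveOperator A) := by
  have : CompleteSpace (GraphDomain A) := GraphDomain.completeSpace A hA.isClosed
  let ε : ℕ → ℝ := fun n => 1 / ((n : ℝ) + 1)
  have hε : ∀ n, 0 < ε n := fun n => by positivity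
  have hε0 : Tendsto ε atTop (𝓝 0) := tendsto_one_div_add_atTop_nhds_zero_nat
  choose J hJ using fun n => exists_isResolvent hA (hε n)
  have hlim := IsResolvent.tendsto_incl hA hε hε0 hJ
  have hreg : IsRegularization (waveOperator A) (fun n => phaseReg (J n))
      (fun n => phaseYosida (ε n) (J n)) := by
    refine ⟨fun n x => (hJ n).mem_graph (hε n) x, fun z => tendsto_phase (hlim _) ?_ (hlim _)⟩
    refine (hlim (opPos z)).congr fun n => ?_
    exact ((hJ n).op_incl hA (hε n) z.fst).symm
  refine ⟨⟨_, _, hreg⟩, exists_isC0GroupGeneratedBy (isClosed_graph_waveOperator hA.isClosed)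
    hreg (fun n x y h => (hJ n).phaseYosida_eq hA (hε n) h)
    (fun m n => ?_) fun T => ⟨Real.exp (1 * T), fun n t ht => ?_⟩⟩
  · ext1 z
    change phaseReg (J m) (phaseReg (J n) z) = phaseReg (J n) (phaseReg (J m) z)
    refine phase_ext ?_ ?_
    · simp only [pos_phaseReg]
      rw [(hJ m).incl_comm hA (hε m) (hε n) (hJ n)]
    · simp only [vel_phaseReg]
      rw [(hJ m).incl_comm hA (hε m) (hε n) (hJ n)]
  · exact norm_expGroup_le_of_inner zero_le_one
      ((hJ n).abs_inner_phaseYosida_le hA (hε n)) ht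

end Wave

/-! ### Integral equations and Grönwall with integrable kernels -/

section Caratheodory

theorem intervalIntegrable_of_mem_Icc {E : Type*} [NormedAddCommGroup E] {f : ℝ → E} {T t : ℝ}
    (hf : IntervalIntegrable f volume 0 T) (ht : t ∈ Icc 0 T) :
    IntervalIntegrable f volume 0 t :=
  hf.mono_set (by rw [uIcc_of_le ht.1, uIcc_of_le (ht.1.trans ht.2)]; exact Icc_subset_Icc_right ht.2)

theorem integral_exp_weight_le {μ t : ℝ} (hμ : 0 < μ) :
    ∫ s in (0 : ℝ)..t, Real.exp (-(μ * (t - s))) ≤ 1 / μ := by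
  have hd : ∀ s ∈ uIcc 0 t, HasDerivAt (fun r => Real.exp (-(μ * (t - r))) / μ)
      (Real.exp (-(μ * (t - s)))) s := by
    intro s _
    have h1 : HasDerivAt (fun r : ℝ => -(μ * (t - r))) (-(μ * (-1))) s :=
      (((hasDerivAt_id s).const_sub t).const_mul μ).neg
    refine (h1.exp.div_const μ).congr_deriv ?_
    field_simp
  rw [intervalIntegral.integral_eq_sub_of_hasDerivAt hd
    (Continuous.intervalIntegrable (by fun_prop) _ _)]
  have : 0 < Real.exp (-(μ * (t - 0))) / μ := by positivity
  simp only [sub_self, mul_zero, neg_zero, Real.exp_zero]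
  linarith

/-- For `k ∈ L¹(0, T)` the exponentially weighted integrals `∫₀ᵗ e^{-μ (t - s)} k(s) ds` are small,
uniformly in `t`, when `μ` is large. -/
theorem exists_exp_weight {k : ℝ → ℝ} {T : ℝ} (hT : 0 ≤ T)
    (hk : IntervalIntegrable k volume 0 T) (hk0 : ∀ s, 0 ≤ k s) :
    ∃ μ : ℝ, 0 < μ ∧ ∀ t ∈ Icc 0 T, ∫ s in (0 : ℝ)..t, Real.exp (-(μ * (t - s))) * k s ≤ 1 / 2 := by
  have hmeas : ∀ n : ℕ, AEStronglyMeasurable (fun s => k s - min (k s) n)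
      (volume.restrict (uIoc 0 T)) := fun n => by
    have := hk.def'.aestronglyMeasurable
    exact this.sub (this.inf aestronglyMeasurable_const)
  have hbd : ∀ (n : ℕ) s, ‖k s - min (k s) n‖ ≤ k s := by
    intro n s
    have h1 : (0 : ℝ) ≤ min (k s) n := le_min (hk0 s) n.cast_nonneg
    rw [Real.norm_of_nonneg (by linarith [min_le_left (k s) n])]
    linarith
  -- Truncate `k` at height `n`: the excess has small integral for large `n`, and the bounded part
  -- is damped by the weight.
  have hlim : Tendsto (fun n : ℕ => ∫ s in (0 : ℝ)..T, (k s - min (k s) n)) atTop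
      (𝓝 (∫ s in (0 : ℝ)..T, (0 : ℝ))) := by
    refine intervalIntegral.tendsto_integral_filter_of_dominated_convergence k
      (Eventually.of_forall hmeas) (Eventually.of_forall fun n => ae_of_all _ fun s _ => hbd n s)
      hk (ae_of_all _ fun s _ => ?_)
    obtain ⟨N, hN⟩ := exists_nat_ge (k s)
    refine tendsto_const_nhds.congr' ?_
    filter_upwards [eventually_ge_atTop N] with n hn
    have : k s ≤ n := hN.trans (by exact_mod_cast hn)
    rw [min_eq_left this, sub_self]
  rw [intervalIntegral.integral_zero] at hlim
  obtain ⟨n, hn⟩ := (hlim.eventually_lt_const (by norm_num : (0 : ℝ) < 1 / 4)).exists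
  have hint : ∀ t ∈ Icc 0 T, IntervalIntegrable (fun s => k s - min (k s) n) volume 0 t :=
    fun t ht => intervalIntegrable_of_mem_Icc (hk.mono_fun (hmeas n)
      (ae_of_all _ fun s => (hbd n s).trans (le_abs_self _))) ht
  -- The truncated part contributes at most `n / μ`, which this choice keeps below `1 / 4`; the `+
  -- 1` gives `μ > 0` when `n = 0`.
  refine ⟨4 * n + 1, by positivity, fun t ht => ?_⟩
  set μ : ℝ := 4 * n + 1
  have hμ : 0 < μ := by positivity
  have hcont : Continuous fun s => Real.exp (-(μ * (t - s))) := by fun_prop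
  calc ∫ s in (0 : ℝ)..t, Real.exp (-(μ * (t - s))) * k s
      ≤ ∫ s in (0 : ℝ)..t, (n * Real.exp (-(μ * (t - s))) + (k s - min (k s) n)) := by
        refine intervalIntegral.integral_mono_on ht.1
          ((intervalIntegrable_of_mem_Icc hk ht).continuousOn_mul hcont.continuousOn)
          (((hcont.intervalIntegrable _ _).const_mul _).add (hint t ht)) fun s hs => ?_
        have h1 : Real.exp (-(μ * (t - s))) ≤ 1 := by
          rw [Real.exp_le_one_iff]
          have := mul_nonneg hμ.le (sub_nonneg.2 hs.2)
          linarith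
        have h2 : min (k s) n ≤ n := min_le_right _ _
        have h3 : min (k s) n ≤ k s := min_le_left _ _
        have h4 := Real.exp_pos (-(μ * (t - s)))
        nlinarith
    _ = n * (∫ s in (0 : ℝ)..t, Real.exp (-(μ * (t - s))))
        + ∫ s in (0 : ℝ)..t, (k s - min (k s) n) := by
        rw [intervalIntegral.integral_add ((hcont.intervalIntegrable _ _).const_mul _) (hint t ht),
          intervalIntegral.integral_const_mul]
    _ ≤ n * (1 / μ) + ∫ s in (0 : ℝ)..T, (k s - min (k s) n) := by
        gcongr
        · exact integral_exp_weight_le hμ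
        · refine intervalIntegral.integral_mono_interval le_rfl ht.1 ht.2
            (ae_of_all _ fun s => ?_) (hint T ⟨hT, le_rfl⟩)
          change 0 ≤ k s - min (k s) n
          linarith [min_le_left (k s) n]
    _ ≤ 1 / 4 + 1 / 4 := by
        gcongr
        rw [mul_one_div, div_le_iff₀ hμ]
        simp only [μ]
        linarith
    _ = _ := by norm_num

/-- Uniqueness form of Grönwall's inequality with an integrable kernel. -/
theorem eq_zero_of_le_integral {k φ : ℝ → ℝ} {T : ℝ} (hT : 0 ≤ T)
    (hk : IntervalIntegrable k volume 0 T) (hk0 : ∀ s, 0 ≤ k s)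
    (hφ : ContinuousOn φ (Icc 0 T)) (hφ0 : ∀ t ∈ Icc 0 T, 0 ≤ φ t)
    (h : ∀ t ∈ Icc 0 T, φ t ≤ ∫ s in (0 : ℝ)..t, k s * φ s) :
    ∀ t ∈ Icc 0 T, φ t = 0 := by
  obtain ⟨μ, hμ, hw⟩ := exists_exp_weight hT hk hk0
  have hc : ContinuousOn (fun t => Real.exp (-(μ * t)) * φ t) (Icc 0 T) :=
    ContinuousOn.mul (by fun_prop) hφ
  -- At the maximum `M` of the weighted function the integral inequality reads `M ≤ M / 2`.
  obtain ⟨t₀, ht₀, hmax⟩ := isCompact_Icc.exists_isMaxOn ⟨0, left_mem_Icc.2 hT⟩ hc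
  set M := Real.exp (-(μ * t₀)) * φ t₀ with hM
  have hle : ∀ s ∈ Icc 0 T, Real.exp (-(μ * s)) * φ s ≤ M := fun s hs => hmax hs
  have hM0 : 0 ≤ M := mul_nonneg (Real.exp_pos _).le (hφ0 _ ht₀)
  have hsub : uIcc 0 t₀ ⊆ Icc 0 T := by
    rw [uIcc_of_le ht₀.1]; exact Icc_subset_Icc_right ht₀.2
  have hkt := intervalIntegrable_of_mem_Icc hk ht₀
  have hM2 : M ≤ M * (1 / 2) := by
    calc M ≤ Real.exp (-(μ * t₀)) * ∫ s in (0 : ℝ)..t₀, k s * φ s := by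
          rw [hM]; gcongr; exact h t₀ ht₀
      _ = ∫ s in (0 : ℝ)..t₀, Real.exp (-(μ * t₀)) * (k s * φ s) :=
          (intervalIntegral.integral_const_mul _ _).symm
      _ ≤ ∫ s in (0 : ℝ)..t₀, M * (Real.exp (-(μ * (t₀ - s))) * k s) := by
          refine intervalIntegral.integral_mono_on ht₀.1
            ((hkt.mul_continuousOn (hφ.mono hsub)).const_mul _)
            ((hkt.continuousOn_mul (by fun_prop)).const_mul _) fun s hs => ?_
          have e : Real.exp (-(μ * t₀)) = Real.exp (-(μ * (t₀ - s))) * Real.exp (-(μ * s)) := by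
            rw [← Real.exp_add]; ring_nf
          rw [e]
          calc _ = (Real.exp (-(μ * (t₀ - s))) * k s) * (Real.exp (-(μ * s)) * φ s) := by ring
            _ ≤ (Real.exp (-(μ * (t₀ - s))) * k s) * M := by
              have := hk0 s
              gcongr
              exact hle s ⟨hs.1, hs.2.trans ht₀.2⟩
            _ = _ := by ring
      _ = M * ∫ s in (0 : ℝ)..t₀, Real.exp (-(μ * (t₀ - s))) * k s :=
          intervalIntegral.integral_const_mul _ _
      _ ≤ M * (1 / 2) := by gcongr; exact hw t₀ ht₀
  intro t ht
  have h1 := hle t ht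
  have h2 := hφ0 t ht
  have h3 := Real.exp_pos (-(μ * t))
  by_contra hne
  have : 0 < Real.exp (-(μ * t)) * φ t := mul_pos h3 (lt_of_le_of_ne h2 (Ne.symm hne))
  linarith

variable {X : Type*} [NormedAddCommGroup X] [NormedSpace ℝ X] [CompleteSpace X]

/-- Carathéodory's existence theorem for an integral equation whose right-hand side is Lipschitz
with an integrable constant. -/
theorem exists_integral_equation {G : ℝ → X → X} {k : ℝ → ℝ} {T : ℝ} (hT : 0 ≤ T)
    (hk : IntervalIntegrable k volume 0 T) (hk0 : ∀ s, 0 ≤ k s)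
    (hlip : ∀ s ∈ Icc 0 T, ∀ x y, ‖G s x - G s y‖ ≤ k s * ‖x - y‖)
    (hint : ∀ w : ℝ → X, Continuous w → IntervalIntegrable (fun s => G s (w s)) volume 0 T)
    (w₀ : X) :
    ∃ w : ℝ → X, Continuous w ∧ ∀ t ∈ Icc 0 T, w t = w₀ + ∫ s in (0 : ℝ)..t, G s (w s) := by
  obtain ⟨μ, hμ, hw⟩ := exists_exp_weight hT hk hk0
  -- The unknown is `y(t) = e^{-μ t} w(t)`, so that the plain sup norm on `y` is the weighted norm
  -- on `w`; `ext y` is `w`.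
  let ext : C(Icc 0 T, X) → ℝ → X := fun y s => Real.exp (μ * s) • IccExtend hT y s
  have hext : ∀ y, Continuous (ext y) := fun y =>
    Continuous.smul (by fun_prop) y.continuous.Icc_extend'
  have hprim : ∀ y, ContinuousOn (fun t => ∫ s in (0 : ℝ)..t, G s (ext y s)) (Icc 0 T) := by
    intro y
    have := intervalIntegral.continuousOn_primitive_interval' (hint _ (hext y)) left_mem_uIcc
    rwa [uIcc_of_le hT] at this
  let Φ : C(Icc 0 T, X) → C(Icc 0 T, X) := fun y =>
    ⟨fun t => Real.exp (-(μ * t)) • (w₀ + ∫ s in (0 : ℝ)..t, G s (ext y s)),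
      Continuous.smul (by fun_prop) (continuous_const.add (hprim y).domRestrict)⟩
  have hΦ : ∀ y t, Φ y t = Real.exp (-(μ * t)) • (w₀ + ∫ s in (0 : ℝ)..t, G s (ext y s)) :=
    fun _ _ => rfl
  have hcontr : ContractingWith (1 / 2) Φ := by
    refine ⟨by rw [← NNReal.coe_lt_coe]; norm_num, LipschitzWith.of_dist_le_mul fun y y' => ?_⟩
    refine (ContinuousMap.dist_le (by positivity)).2 fun t => ?_
    have ht := t.2
    have hi := intervalIntegrable_of_mem_Icc (hint _ (hext y)) ht
    have hi' := intervalIntegrable_of_mem_Icc (hint _ (hext y')) ht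
    have hkt := intervalIntegrable_of_mem_Icc hk ht
    have e : Φ y t - Φ y' t = Real.exp (-(μ * t)) •
        ∫ s in (0 : ℝ)..t, (G s (ext y s) - G s (ext y' s)) := by
      rw [intervalIntegral.integral_sub hi hi', hΦ, hΦ, ← smul_sub, add_sub_add_left_eq_sub]
    rw [dist_eq_norm, e, norm_smul, Real.norm_of_nonneg (Real.exp_pos _).le]
    calc Real.exp (-(μ * t)) * ‖∫ s in (0 : ℝ)..t, (G s (ext y s) - G s (ext y' s))‖
        ≤ Real.exp (-(μ * t)) * ∫ s in (0 : ℝ)..t, k s * (Real.exp (μ * s) * dist y y') := by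
          gcongr
          refine intervalIntegral.norm_integral_le_of_norm_le ht.1
            (ae_of_all _ fun s hs => ?_) (hkt.mul_continuousOn (by fun_prop))
          have hs' : s ∈ Icc 0 T := ⟨hs.1.le, hs.2.trans ht.2⟩
          refine (hlip s hs' _ _).trans ?_
          have := hk0 s
          gcongr
          simp only [ext]
          rw [← smul_sub, norm_smul, Real.norm_of_nonneg (Real.exp_pos _).le, ← dist_eq_norm,
            IccExtend_of_mem hT _ hs', IccExtend_of_mem hT _ hs']
          gcongr
          exact ContinuousMap.dist_apply_le_dist _
      _ = (∫ s in (0 : ℝ)..t, Real.exp (-(μ * (t - s))) * k s) * dist y y' := by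
          rw [← intervalIntegral.integral_const_mul, ← intervalIntegral.integral_mul_const]
          refine intervalIntegral.integral_congr fun s _ => ?_
          have : Real.exp (-(μ * (t - s))) = Real.exp (-(μ * t)) * Real.exp (μ * s) := by
            rw [← Real.exp_add]; ring_nf
          simp only [this]
          ring
      _ ≤ _ := by
          have := hw t ht
          push_cast
          gcongr
  let y := hcontr.fixedPoint Φ
  have hy : Φ y = y := hcontr.fixedPoint_isFixedPt
  refine ⟨ext y, hext y, fun t ht => ?_⟩
  have h1 : y ⟨t, ht⟩ = Real.exp (-(μ * t)) • (w₀ + ∫ s in (0 : ℝ)..t, G s (ext y s)) := by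
    conv_lhs => rw [← hy]
    rfl
  change Real.exp (μ * t) • IccExtend hT y t = _
  rw [IccExtend_of_mem hT _ ht, h1, smul_smul, ← Real.exp_add, add_neg_cancel, Real.exp_zero,
    one_smul]

end Caratheodory

/-! ### The chain rule along mild solutions -/

section ChainRule

variable {X : Type*} [NormedAddCommGroup X] [NormedSpace ℝ X] [CompleteSpace X]
  {Y : Type*} [NormedAddCommGroup Y] [NormedSpace ℝ Y] [CompleteSpace Y]
  {G : X →ₗ.[ℝ] X} {S : ℝ → X →L[ℝ] X}

theorem aestronglyMeasurable_comp_prodMk {E F : Type*} [TopologicalSpace E] [TopologicalSpace F]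
    [TopologicalSpace.PseudoMetrizableSpace E] [TopologicalSpace.PseudoMetrizableSpace F]
    {Φ : ℝ × E → F} (hΦ : Continuous Φ) {p : ℝ → E} {ν : Measure ℝ}
    (hp : AEStronglyMeasurable p ν) : AEStronglyMeasurable (fun s => Φ (s, p s)) ν :=
  hΦ.comp_aestronglyMeasurable (continuous_id.aestronglyMeasurable.prodMk hp)

theorem IsRegularization.exists_bound {R Gn : ℕ → X →L[ℝ] X} (h : IsRegularization G R Gn) :
    ∃ B, 0 ≤ B ∧ ∀ n, ‖R n‖ ≤ B := by
  obtain ⟨C, hC⟩ := banach_steinhaus (g := R) fun x => by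
    obtain ⟨C, hC⟩ := (h.tendsto x).norm.bddAbove_range
    exact ⟨C, fun n => hC ⟨n, rfl⟩⟩
  exact ⟨max C 0, le_max_right _ _, fun n => (hC n).trans (le_max_left _ _)⟩

/-- Chain rule along a mild solution, for a globally integrable forcing. -/
theorem chain_rule_of_integrable (hS : IsC0GroupGeneratedBy S G) {R Gn : ℕ → X →L[ℝ] X}
    (hreg : IsRegularization G R Gn) {Q : X → Y} {Q' : X → X →L[ℝ] Y} {q : X → Y}
    (hQ : ∀ x, HasFDerivAt Q (Q' x) x) (hQ'c : Continuous Q') (hqc : Continuous q)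
    (hQ'b : ∀ r : ℝ, ∃ C, ∀ x, ‖x‖ ≤ r → ‖Q' x‖ ≤ C)
    (hqb : ∀ r : ℝ, ∃ C, ∀ x, ‖x‖ ≤ r → ‖q x‖ ≤ C)
    (hG : ∀ x y, (x, y) ∈ G.graph → Q' x y = q x) {T : ℝ} (hT : 0 ≤ T) {p : ℝ → X}
    (hp : Integrable p) {w : ℝ → X} {w₀ : X}
    (hw : ∀ t, w t = w₀ + ∫ s in (0 : ℝ)..t, p s) :
    IntervalIntegrable (fun s => q (S s (w s)) + Q' (S s (w s)) (S s (p s))) volume 0 T ∧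
    Q (S T (w T)) = Q w₀ + ∫ s in (0 : ℝ)..T, (q (S s (w s)) + Q' (S s (w s)) (S s (p s))) := by
  obtain ⟨K, hK0, hK⟩ := hS.isC0Group.exists_bound T
  have hK' : ∀ s ∈ Icc 0 T, ∀ x, ‖S s x‖ ≤ K * ‖x‖ := fun s hs x =>
    (S s).le_of_opNorm_le (hK s ⟨by linarith [hs.1], hs.2⟩) x
  obtain ⟨B, hB0, hB⟩ := hreg.exists_bound
  have hB' : ∀ n x, ‖R n x‖ ≤ B * ‖x‖ := fun n x => (R n).le_of_opNorm_le (hB n) x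
  have hwc : Continuous w := by
    rw [funext hw]
    exact continuous_const.add
      (intervalIntegral.continuous_primitive (fun _ _ => hp.intervalIntegrable) 0)
  obtain ⟨D, hD⟩ := (isCompact_Icc (a := (0 : ℝ)) (b := T)).exists_bound_of_continuousOn
    hwc.continuousOn
  have hD0 : 0 ≤ D := (norm_nonneg _).trans (hD 0 ⟨le_rfl, hT⟩)
  -- With `p` replaced by continuous `g n`, close in `L¹`, and the result regularised by `R n`, the
  -- curve `z n` is differentiable and stays in the domain, so the ordinary chain rule applies
  -- before the limit.
  choose g _ hg1 hgc hgi using fun n : ℕ =>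
    hp.exists_hasCompactSupport_integral_sub_le (E := X) (ε := 1 / ((n : ℝ) + 1)) (by positivity)
  let W : ℕ → ℝ → X := fun n t => w₀ + ∫ s in (0 : ℝ)..t, g n s
  have hWd : ∀ n t, HasDerivAt (W n) (g n t) t := fun n t =>
    ((hgc n).integral_hasStrictDerivAt 0 t).hasDerivAt.const_add w₀
  have hgp : ∀ n, ∀ t ∈ Icc 0 T, ∫ s in (0 : ℝ)..t, ‖p s - g n s‖ ≤ 1 / ((n : ℝ) + 1) := by
    intro n t ht
    rw [intervalIntegral.integral_of_le ht.1]
    exact (setIntegral_le_integral (hp.sub (hgi n)).norm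
      (ae_of_all _ fun _ => norm_nonneg _)).trans (hg1 n)
  have hWw : ∀ n, ∀ t ∈ Icc 0 T, ‖W n t - w t‖ ≤ 1 / ((n : ℝ) + 1) := by
    intro n t ht
    have e : W n t - w t = -∫ s in (0 : ℝ)..t, (p s - g n s) := by
      rw [hw, intervalIntegral.integral_sub hp.intervalIntegrable (hgi n).intervalIntegrable]
      simp only [W]
      abel
    rw [e, norm_neg]
    exact (intervalIntegral.norm_integral_le_integral_norm ht.1).trans (hgp n t ht)
  have hone : ∀ n : ℕ, 1 / ((n : ℝ) + 1) ≤ 1 := fun n => by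
    rw [div_le_one (by positivity)]
    linarith [n.cast_nonneg (α := ℝ)]
  let z : ℕ → ℝ → X := fun n t => S t (R n (W n t))
  have hzc : ∀ n, Continuous (z n) := fun n =>
    hS.isC0Group.continuous_apply continuous_id
      ((R n).continuous.comp (continuous_iff_continuousAt.2 fun t => (hWd n t).continuousAt))
  let r := K * (B * (D + 1))
  have hzb : ∀ n, ∀ t ∈ Icc 0 T, ‖z n t‖ ≤ r := by
    intro n t ht
    refine (hK' t ht _).trans (mul_le_mul_of_nonneg_left ((hB' n _).trans ?_) hK0)
    refine mul_le_mul_of_nonneg_left ?_ hB0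
    calc ‖W n t‖ = ‖w t + (W n t - w t)‖ := by congr 1; abel
      _ ≤ ‖w t‖ + ‖W n t - w t‖ := norm_add_le _ _
      _ ≤ D + 1 := add_le_add (hD t ht) ((hWw n t ht).trans (hone n))
  obtain ⟨Cq, hCq⟩ := hqb r
  obtain ⟨CQ, hCQ⟩ := hQ'b r
  have hCQ0 : 0 ≤ CQ := (norm_nonneg _).trans (hCQ _ (hzb 0 0 ⟨le_rfl, hT⟩))
  have hRW : ∀ t ∈ Icc 0 T, Tendsto (fun n => R n (W n t)) atTop (𝓝 (w t)) := by
    intro t ht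
    have h1 : Tendsto (fun n => R n (W n t - w t)) atTop (𝓝 0) := by
      have h2 : Tendsto (fun n : ℕ => B * (1 / ((n : ℝ) + 1))) atTop (𝓝 0) := by
        simpa using tendsto_one_div_add_atTop_nhds_zero_nat.const_mul B
      exact squeeze_zero_norm (fun n => (hB' n _).trans
        (mul_le_mul_of_nonneg_left (hWw n t ht) hB0)) h2
    simpa using h1.add (hreg.tendsto (w t))
  have hzlim : ∀ t ∈ Icc 0 T, Tendsto (fun n => z n t) atTop (𝓝 (S t (w t))) := fun t ht =>
    ((S t).continuous.tendsto _).comp (hRW t ht)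
  have hderiv : ∀ n t, HasDerivAt (fun s => Q (z n s))
      (q (z n t) + Q' (z n t) (S t (R n (g n t)))) t := by
    intro n t
    have h1 : HasDerivAt (fun s => R n (W n s)) (R n (g n t)) t :=
      (R n).hasFDerivAt.comp_hasDerivAt t (hWd n t)
    have h2 := hS.hasDerivAt_apply h1 (hreg.mem_graph n (W n t))
    have h3 := (hQ (z n t)).comp_hasDerivAt t h2
    rw [map_add, hG _ _ (hS.apply_mem_graph (hreg.mem_graph n (W n t)) t)] at h3
    exact h3
  have hc1 : ∀ n, Continuous fun s => q (z n s) := fun n => hqc.comp (hzc n)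
  have hc2 : ∀ n, Continuous fun s => Q' (z n s) (S s (R n (g n s))) := fun n =>
    (hQ'c.comp (hzc n)).clm_apply
      (hS.isC0Group.continuous_apply continuous_id ((R n).continuous.comp (hgc n)))
  have hi2 : ∀ n, IntervalIntegrable (fun s => Q' (z n s) (S s (R n (g n s)))) volume 0 T :=
    fun n => (hc2 n).intervalIntegrable _ _
  have hFTC : ∀ n, (∫ s in (0 : ℝ)..T, q (z n s))
      + ∫ s in (0 : ℝ)..T, Q' (z n s) (S s (R n (g n s))) = Q (z n T) - Q (z n 0) := by
    intro n
    rw [← intervalIntegral.integral_add ((hc1 n).intervalIntegrable _ _) (hi2 n)]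
    exact intervalIntegral.integral_eq_sub_of_hasDerivAt (fun t _ => hderiv n t)
      (((hc1 n).add (hc2 n)).intervalIntegrable _ _)
  have hsub : uIoc 0 T ⊆ Icc 0 T := by
    rw [uIoc_of_le hT]; exact Ioc_subset_Icc_self
  have hl1 : Tendsto (fun n => ∫ s in (0 : ℝ)..T, q (z n s)) atTop
      (𝓝 (∫ s in (0 : ℝ)..T, q (S s (w s)))) :=
    intervalIntegral.tendsto_integral_filter_of_dominated_convergence (fun _ => Cq)
      (Eventually.of_forall fun n => (hc1 n).aestronglyMeasurable)
      (Eventually.of_forall fun n => ae_of_all _ fun s hs => hCq _ (hzb n s (hsub hs)))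
      intervalIntegrable_const
      (ae_of_all _ fun s hs => (hqc.tendsto _).comp (hzlim s (hsub hs)))
  have hcF : ∀ n, Continuous fun a : ℝ × X => Q' (z n a.1) (S a.1 (R n a.2)) := fun n =>
    (hQ'c.comp ((hzc n).comp continuous_fst)).clm_apply
      (hS.isC0Group.continuous_apply continuous_fst ((R n).continuous.comp continuous_snd))
  have hm3 : ∀ n, AEStronglyMeasurable (fun s => Q' (z n s) (S s (R n (p s)))) volume := fun n =>
    aestronglyMeasurable_comp_prodMk (hcF n) hp.aestronglyMeasurable
  have hbF : ∀ n, ∀ s ∈ Icc 0 T, ∀ x, ‖Q' (z n s) (S s (R n x))‖ ≤ CQ * (K * B) * ‖x‖ := by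
    intro n s hs x
    calc _ ≤ CQ * ‖S s (R n x)‖ := (Q' (z n s)).le_of_opNorm_le (hCQ _ (hzb n s hs)) _
      _ ≤ CQ * (K * (B * ‖x‖)) := by
        gcongr
        exact (hK' s hs _).trans (by gcongr; exact hB' n x)
      _ = _ := by ring
  have hi3 : ∀ n, IntervalIntegrable (fun s => Q' (z n s) (S s (R n (p s)))) volume 0 T := by
    intro n
    rw [intervalIntegrable_iff]
    refine Integrable.mono' ((hp.norm.const_mul (CQ * (K * B))).restrict)
      (hm3 n).restrict ?_
    exact (ae_restrict_iff' measurableSet_uIoc).2 (ae_of_all _ fun s hs => hbF n s (hsub hs) _)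
  -- No pointwise control of `g n` is available. The limit is taken with `p` in its place, dominated
  -- by a multiple of `‖p‖`; `hl4` bounds the replacement error by the `L¹` distance.
  have hl3 : Tendsto (fun n => ∫ s in (0 : ℝ)..T, Q' (z n s) (S s (R n (p s)))) atTop
      (𝓝 (∫ s in (0 : ℝ)..T, Q' (S s (w s)) (S s (p s)))) :=
    intervalIntegral.tendsto_integral_filter_of_dominated_convergence
      (fun s => CQ * (K * B) * ‖p s‖)
      (Eventually.of_forall fun n => (hm3 n).restrict)
      (Eventually.of_forall fun n => ae_of_all _ fun s hs => hbF n s (hsub hs) _)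
      (hp.norm.const_mul _).intervalIntegrable
      (ae_of_all _ fun s hs => (isBoundedBilinearMap_apply.continuous.tendsto _).comp
        (((hQ'c.tendsto _).comp (hzlim s (hsub hs))).prodMk_nhds
          (((S s).continuous.tendsto _).comp (hreg.tendsto (p s)))))
  have hl4 : Tendsto (fun n => ∫ s in (0 : ℝ)..T,
      (Q' (z n s) (S s (R n (p s))) - Q' (z n s) (S s (R n (g n s))))) atTop (𝓝 0) := by
    have h2 : Tendsto (fun n : ℕ => CQ * (K * B) * (1 / ((n : ℝ) + 1))) atTop (𝓝 0) := by
      simpa using tendsto_one_div_add_atTop_nhds_zero_nat.const_mul (CQ * (K * B))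
    refine squeeze_zero_norm (fun n => ?_) h2
    have hi := ((hp.sub (hgi n)).norm.const_mul (CQ * (K * B)))
    calc _ ≤ ∫ s in (0 : ℝ)..T, CQ * (K * B) * ‖p s - g n s‖ := by
          refine intervalIntegral.norm_integral_le_of_norm_le hT (ae_of_all _ fun s hs => ?_)
            hi.intervalIntegrable
          rw [← map_sub, ← map_sub, ← map_sub]
          exact hbF n s ⟨hs.1.le, hs.2⟩ _
      _ = CQ * (K * B) * ∫ s in (0 : ℝ)..T, ‖p s - g n s‖ :=
          intervalIntegral.integral_const_mul _ _
      _ ≤ _ := by gcongr; exact hgp n T ⟨hT, le_rfl⟩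
  have hl2 : Tendsto (fun n => ∫ s in (0 : ℝ)..T, Q' (z n s) (S s (R n (g n s)))) atTop
      (𝓝 (∫ s in (0 : ℝ)..T, Q' (S s (w s)) (S s (p s)))) := by
    have := hl3.sub hl4
    rw [sub_zero] at this
    refine this.congr fun n => ?_
    rw [intervalIntegral.integral_sub (hi3 n) (hi2 n)]
    abel
  have hQc : Continuous Q := continuous_iff_continuousAt.2 fun x => (hQ x).continuousAt
  have hl5 : Tendsto (fun n => Q (z n T) - Q (z n 0)) atTop (𝓝 (Q (S T (w T)) - Q w₀)) := by
    have h0 : S 0 (w 0) = w₀ := by rw [hS.isC0Group.apply_zero, hw]; simp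
    have h1 := (hQc.tendsto _).comp (hzlim 0 ⟨le_rfl, hT⟩)
    rw [h0] at h1
    exact ((hQc.tendsto _).comp (hzlim T ⟨hT, le_rfl⟩)).sub h1
  have hfin := tendsto_nhds_unique ((hl1.add hl2).congr hFTC) hl5
  have hSwc : Continuous fun s => S s (w s) := hS.isC0Group.continuous_apply continuous_id hwc
  have hj1 : IntervalIntegrable (fun s => q (S s (w s))) volume 0 T :=
    (hqc.comp hSwc).intervalIntegrable _ _
  have hj2 : IntervalIntegrable (fun s => Q' (S s (w s)) (S s (p s))) volume 0 T := by
    obtain ⟨C, hC⟩ := (isCompact_Icc (a := (0 : ℝ)) (b := T)).exists_bound_of_continuousOn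
      (hQ'c.comp hSwc).continuousOn
    have hcont : Continuous fun a : ℝ × X => Q' (S a.1 (w a.1)) (S a.1 a.2) :=
      (hQ'c.comp (hSwc.comp continuous_fst)).clm_apply
        (hS.isC0Group.continuous_apply continuous_fst continuous_snd)
    rw [intervalIntegrable_iff]
    refine Integrable.mono' ((hp.norm.const_mul (C * K)).restrict)
      (aestronglyMeasurable_comp_prodMk hcont hp.aestronglyMeasurable).restrict ?_
    refine (ae_restrict_iff' measurableSet_uIoc).2 (ae_of_all _ fun s hs => ?_)
    have hC0 : 0 ≤ C := (norm_nonneg _).trans (hC s (hsub hs))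
    calc _ ≤ C * ‖S s (p s)‖ := (Q' (S s (w s))).le_of_opNorm_le (hC s (hsub hs)) _
      _ ≤ C * (K * ‖p s‖) := by gcongr; exact hK' s (hsub hs) _
      _ = _ := by ring
  refine ⟨hj1.add hj2, ?_⟩
  rw [intervalIntegral.integral_add hj1 hj2, hfin]
  abel

/-- Chain rule along a mild solution `z(t) = S(t) (w₀ + ∫₀ᵗ p)`. -/
theorem chain_rule (hS : IsC0GroupGeneratedBy S G) {R Gn : ℕ → X →L[ℝ] X}
    (hreg : IsRegularization G R Gn) {Q : X → Y} {Q' : X → X →L[ℝ] Y} {q : X → Y}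
    (hQ : ∀ x, HasFDerivAt Q (Q' x) x) (hQ'c : Continuous Q') (hqc : Continuous q)
    (hQ'b : ∀ r : ℝ, ∃ C, ∀ x, ‖x‖ ≤ r → ‖Q' x‖ ≤ C)
    (hqb : ∀ r : ℝ, ∃ C, ∀ x, ‖x‖ ≤ r → ‖q x‖ ≤ C)
    (hG : ∀ x y, (x, y) ∈ G.graph → Q' x y = q x) {T : ℝ} {p : ℝ → X}
    (hp : IntervalIntegrable p volume 0 T) {z : ℝ → X} {w₀ : X}
    (hz : ∀ t ∈ Icc 0 T, z t = S t (w₀ + ∫ s in (0 : ℝ)..t, p s)) {t : ℝ} (ht : t ∈ Icc 0 T) :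
    IntervalIntegrable (fun s => q (z s) + Q' (z s) (S s (p s))) volume 0 t ∧
    Q (z t) = Q w₀ + ∫ s in (0 : ℝ)..t, (q (z s) + Q' (z s) (S s (p s))) := by
  have hp' : Integrable ((Ioc 0 T).indicator p) := by
    rw [integrable_indicator_iff measurableSet_Ioc]
    exact (intervalIntegrable_iff_integrableOn_Ioc_of_le (ht.1.trans ht.2)).1 hp
  have hind : ∀ r ∈ Icc 0 T, ∀ s ∈ uIoc 0 r, (Ioc 0 T).indicator p s = p s := by
    intro r hr s hs
    rw [uIoc_of_le hr.1] at hs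
    exact indicator_of_mem (show s ∈ Ioc 0 T from ⟨hs.1, hs.2.trans hr.2⟩) _
  have hint : ∀ r ∈ Icc 0 T, ∫ s in (0 : ℝ)..r, (Ioc 0 T).indicator p s
      = ∫ s in (0 : ℝ)..r, p s := fun r hr =>
    intervalIntegral.integral_congr_ae (ae_of_all _ fun s hs => hind r hr s hs)
  obtain ⟨h1, h2⟩ := chain_rule_of_integrable hS hreg hQ hQ'c hqc hQ'b hqb hG ht.1 hp'
    (w := fun t => w₀ + ∫ s in (0 : ℝ)..t, (Ioc 0 T).indicator p s) fun _ => rfl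
  have hzz : ∀ r ∈ Icc 0 T, S r (w₀ + ∫ s in (0 : ℝ)..r, (Ioc 0 T).indicator p s) = z r :=
    fun r hr => by rw [hint r hr, hz r hr]
  have hcongr : ∀ s ∈ uIoc 0 t,
      q (S s (w₀ + ∫ s in (0 : ℝ)..s, (Ioc 0 T).indicator p s))
        + Q' (S s (w₀ + ∫ s in (0 : ℝ)..s, (Ioc 0 T).indicator p s))
          (S s ((Ioc 0 T).indicator p s)) = q (z s) + Q' (z s) (S s (p s)) := by
    intro s hs
    rw [hind t ht s hs]
    rw [uIoc_of_le ht.1] at hs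
    rw [hzz s ⟨hs.1.le, hs.2.trans ht.2⟩]
  refine ⟨h1.congr hcongr, ?_⟩
  rw [← hzz t ht, h2, intervalIntegral.integral_congr_ae (ae_of_all _ hcongr)]

end ChainRule

/-! ### Local Lipschitz bounds and uniqueness -/

section Nonlinearity

open GraphDomain

variable {H : Type*} [NormedAddCommGroup H] [InnerProductSpace ℝ H] {A : H →ₗ.[ℝ] H}

theorem norm_sq_smul_sub_le {r d : ℝ} {u u' v v' : H} (hv : ‖v‖ ≤ r) (hv' : ‖v'‖ ≤ r)
    (hu' : ‖u'‖ ≤ r) (hud : ‖u - u'‖ ≤ d) (hvd : ‖v - v'‖ ≤ d) :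
    ‖‖v‖ ^ 2 • u - ‖v'‖ ^ 2 • u'‖ ≤ 3 * r ^ 2 * d := by
  have hr : 0 ≤ r := (norm_nonneg _).trans hv
  have hd : 0 ≤ d := (norm_nonneg _).trans hud
  have e : ‖v‖ ^ 2 • u - ‖v'‖ ^ 2 • u' = ‖v‖ ^ 2 • (u - u') + (‖v‖ ^ 2 - ‖v'‖ ^ 2) • u' := by
    rw [smul_sub, sub_smul]; abel
  have h1 : |‖v‖ ^ 2 - ‖v'‖ ^ 2| ≤ 2 * r * d := by
    rw [sq_sub_sq, abs_mul]
    have h2 := abs_norm_sub_norm_le v v'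
    have h3 : |‖v‖ + ‖v'‖| ≤ 2 * r := by rw [abs_of_nonneg (by positivity)]; linarith
    calc _ ≤ (2 * r) * ‖v - v'‖ := by gcongr
      _ ≤ _ := by gcongr
  rw [e]
  calc _ ≤ ‖‖v‖ ^ 2 • (u - u')‖ + ‖(‖v‖ ^ 2 - ‖v'‖ ^ 2) • u'‖ := norm_add_le _ _
    _ = ‖v‖ ^ 2 * ‖u - u'‖ + |‖v‖ ^ 2 - ‖v'‖ ^ 2| * ‖u'‖ := by
      rw [norm_smul, norm_smul, Real.norm_of_nonneg (sq_nonneg _), Real.norm_eq_abs]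
    _ ≤ r ^ 2 * d + 2 * r * d * r := by gcongr
    _ = _ := by ring

theorem norm_tangentProj_sub_le {r : ℝ} {u u' : H} (hu : ‖u‖ ≤ r) (hu' : ‖u'‖ ≤ r) (g : H) :
    ‖tangentProj u g - tangentProj u' g‖ ≤ 2 * r * ‖g‖ * ‖u - u'‖ := by
  have e : tangentProj u g - tangentProj u' g = -(⟪g, u⟫_ℝ • (u - u') + ⟪g, u - u'⟫_ℝ • u') := by
    simp only [tangentProj, inner_sub_right, sub_smul, smul_sub]; abel
  rw [e, norm_neg]
  calc _ ≤ ‖⟪g, u⟫_ℝ • (u - u')‖ + ‖⟪g, u - u'⟫_ℝ • u'‖ := norm_add_le _ _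
    _ ≤ (‖g‖ * ‖u‖) * ‖u - u'‖ + (‖g‖ * ‖u - u'‖) * ‖u'‖ := by
      rw [norm_smul, norm_smul]
      gcongr <;> exact norm_inner_le_norm _ _
    _ ≤ (‖g‖ * r) * ‖u - u'‖ + (‖g‖ * ‖u - u'‖) * r := by gcongr
    _ = _ := by ring

theorem norm_pos_le (z : PhaseSpace A) : ‖pos z‖ ≤ ‖z‖ :=
  abs_le_of_sq_le_sq' (by nlinarith [phase_norm_sq z, sq_nonneg ‖opPos z‖, sq_nonneg ‖vel z‖])
    (norm_nonneg _) |>.2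

theorem norm_vel_le (z : PhaseSpace A) : ‖vel z‖ ≤ ‖z‖ :=
  abs_le_of_sq_le_sq' (by nlinarith [phase_norm_sq z, sq_nonneg ‖opPos z‖, sq_nonneg ‖pos z‖])
    (norm_nonneg _) |>.2

theorem norm_opPos_le (z : PhaseSpace A) : ‖opPos z‖ ≤ ‖z‖ :=
  abs_le_of_sq_le_sq' (by nlinarith [phase_norm_sq z, sq_nonneg ‖pos z‖, sq_nonneg ‖vel z‖])
    (norm_nonneg _) |>.2

theorem continuous_pos : Continuous (pos : PhaseSpace A → H) := (posL A).continuous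

theorem continuous_vel : Continuous (vel : PhaseSpace A → H) := (velL A).continuous

theorem continuous_opPos : Continuous (opPos : PhaseSpace A → H) := (opPosL A).continuous

theorem pos_nonlinearity (γ : ℝ) (z : PhaseSpace A) (g : H) : pos (nonlinearity γ z g) = 0 :=
  map_zero (incl A)

theorem opPos_nonlinearity (γ : ℝ) (z : PhaseSpace A) (g : H) : opPos (nonlinearity γ z g) = 0 :=
  map_zero (op A)

theorem vel_nonlinearity (γ : ℝ) (z : PhaseSpace A) (g : H) :
    vel (nonlinearity γ z g) = -(‖vel z‖ ^ 2 • pos z) + ‖opPos z‖ ^ 2 • pos z - γ • vel z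
      + tangentProj (pos z) g := rfl

theorem continuous_nonlinearity (γ : ℝ) :
    Continuous fun a : PhaseSpace A × H => nonlinearity γ a.1 a.2 := by
  refine (WithLp.prod_continuous_toLp 2 (GraphDomain A) H).comp (continuous_const.prodMk ?_)
  simp only [tangentProj, ← posL_apply, ← velL_apply, ← opPosL_apply]
  fun_prop

/-- Only the velocity component is nonzero. Each of the two cubic terms contributes `3 r²`, the
damping `|γ|`, and the tangential projection `2 r ‖g‖`. -/
theorem norm_nonlinearity_sub_le (γ : ℝ) {r : ℝ} {x y : PhaseSpace A} (hx : ‖x‖ ≤ r)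
    (hy : ‖y‖ ≤ r) (g : H) :
    ‖nonlinearity γ x g - nonlinearity γ y g‖ ≤ (6 * r ^ 2 + |γ| + 2 * r * ‖g‖) * ‖x - y‖ := by
  have hr : 0 ≤ r := (norm_nonneg _).trans hx
  have h1 : ‖pos x - pos y‖ ≤ ‖x - y‖ := by
    rw [← posL_apply, ← posL_apply, ← map_sub]; exact norm_pos_le _
  have h2 : ‖vel x - vel y‖ ≤ ‖x - y‖ := by
    rw [← velL_apply, ← velL_apply, ← map_sub]; exact norm_vel_le _
  have h3 : ‖opPos x - opPos y‖ ≤ ‖x - y‖ := by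
    rw [← opPosL_apply, ← opPosL_apply, ← map_sub]; exact norm_opPos_le _
  have hp : ‖pos (nonlinearity γ x g - nonlinearity γ y g)‖ = 0 := by
    rw [← posL_apply, map_sub, posL_apply, posL_apply, pos_nonlinearity, pos_nonlinearity]; simp
  have ho : ‖opPos (nonlinearity γ x g - nonlinearity γ y g)‖ = 0 := by
    rw [← opPosL_apply, map_sub, opPosL_apply, opPosL_apply, opPos_nonlinearity,
      opPos_nonlinearity]; simp
  have hn : ‖nonlinearity γ x g - nonlinearity γ y g‖
      = ‖vel (nonlinearity γ x g) - vel (nonlinearity γ y g)‖ := by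
    have := phase_norm_sq (nonlinearity γ x g - nonlinearity γ y g)
    rw [hp, ho] at this
    rw [← velL_apply, ← velL_apply, ← map_sub, velL_apply]
    refine (sq_eq_sq₀ (norm_nonneg _) (norm_nonneg _)).1 ?_
    rw [this]; ring
  have e : vel (nonlinearity γ x g) - vel (nonlinearity γ y g)
      = -(‖vel x‖ ^ 2 • pos x - ‖vel y‖ ^ 2 • pos y)
        + (‖opPos x‖ ^ 2 • pos x - ‖opPos y‖ ^ 2 • pos y) - γ • (vel x - vel y)
        + (tangentProj (pos x) g - tangentProj (pos y) g) := by
    rw [vel_nonlinearity, vel_nonlinearity, smul_sub]; abel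
  have b1 := norm_sq_smul_sub_le ((norm_vel_le x).trans hx) ((norm_vel_le y).trans hy)
    ((norm_pos_le y).trans hy) h1 h2
  have b2 := norm_sq_smul_sub_le ((norm_opPos_le x).trans hx) ((norm_opPos_le y).trans hy)
    ((norm_pos_le y).trans hy) h1 h3
  have b3 := norm_tangentProj_sub_le ((norm_pos_le x).trans hx) ((norm_pos_le y).trans hy) g
  have b4 : ‖γ • (vel x - vel y)‖ ≤ |γ| * ‖x - y‖ := by
    rw [norm_smul, Real.norm_eq_abs]; gcongr
  have b5 : 2 * r * ‖g‖ * ‖pos x - pos y‖ ≤ 2 * r * ‖g‖ * ‖x - y‖ := by gcongr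
  rw [hn, e]
  refine (norm_add_le _ _).trans ?_
  refine (add_le_add_left (norm_sub_le _ _) _).trans ?_
  refine (add_le_add_left (add_le_add_left (norm_add_le _ _) _) _).trans ?_
  rw [norm_neg]
  linarith

theorem norm_nonlinearity_zero (γ : ℝ) (g : H) : ‖nonlinearity γ (0 : PhaseSpace A) g‖ = ‖g‖ := by
  have h1 : pos (0 : PhaseSpace A) = 0 := map_zero (incl A)
  have h2 : vel (0 : PhaseSpace A) = 0 := rfl
  have h3 : vel (nonlinearity γ (0 : PhaseSpace A) g) = g := by
    rw [vel_nonlinearity, h1, h2]; simp [tangentProj]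
  have := phase_norm_sq (nonlinearity γ (0 : PhaseSpace A) g)
  rw [pos_nonlinearity, opPos_nonlinearity, h3] at this
  refine (sq_eq_sq₀ (norm_nonneg _) (norm_nonneg _)).1 ?_
  rw [this]; simp

theorem norm_nonlinearity_le (γ : ℝ) {r : ℝ} {x : PhaseSpace A} (hx : ‖x‖ ≤ r) (g : H) :
    ‖nonlinearity γ x g‖ ≤ (6 * r ^ 2 + |γ|) * r + (2 * r * r + 1) * ‖g‖ := by
  have hr : 0 ≤ r := (norm_nonneg _).trans hx
  have h1 := norm_nonlinearity_sub_le γ hx (y := 0) (by simpa using hr) g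
  rw [sub_zero] at h1
  have h2 : ‖nonlinearity γ x g‖ ≤ ‖nonlinearity γ x g - nonlinearity γ 0 g‖ + ‖g‖ := by
    rw [← norm_nonlinearity_zero (A := A) γ g]
    exact norm_le_norm_sub_add _ _
  have h3 : (6 * r ^ 2 + |γ| + 2 * r * ‖g‖) * ‖x‖ ≤ (6 * r ^ 2 + |γ| + 2 * r * ‖g‖) * r := by
    gcongr
  linarith

theorem MemL2Loc.intervalIntegrable {H : Type*} [NormedAddCommGroup H] {f : ℝ → H} (hf : MemL2Loc f) {T : ℝ} (hT : 0 ≤ T) :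
    IntervalIntegrable f volume 0 T := by
  -- `MemL2Loc` speaks of positive times only; `T + 1` covers `T = 0`.
  have h1 := (hf (T + 1) (by linarith)).integrable (by norm_num)
  rw [intervalIntegrable_iff_integrableOn_Icc_of_le hT]
  exact IntegrableOn.mono_set h1 (Icc_subset_Icc_right (by linarith))

variable {S : ℝ → PhaseSpace A →L[ℝ] PhaseSpace A} {γ : ℝ} {f : ℝ → H} {z₀ : PhaseSpace A}
  {z : ℝ → PhaseSpace A} {T : ℝ}

/-- `z` is a mild solution on `[0, T]` for the group `S`, written as
`z(t) = S(t) (z₀ + ∫₀ᵗ S(-s) F(s) ds)`. -/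
structure IsMildOn (S : ℝ → PhaseSpace A →L[ℝ] PhaseSpace A) (γ : ℝ) (f : ℝ → H)
    (z₀ : PhaseSpace A) (z : ℝ → PhaseSpace A) (T : ℝ) : Prop where
  continuousOn : ContinuousOn z (Icc 0 T)
  eq : ∀ t ∈ Icc 0 T, z t = S t (z₀ + ∫ s in (0 : ℝ)..t, S (-s) (nonlinearity γ (z s) (f s)))


theorem IsMildOn.mono (h : IsMildOn S γ f z₀ z T) {T' : ℝ} (hT : T' ≤ T) :
    IsMildOn S γ f z₀ z T' :=
  ⟨h.continuousOn.mono (Icc_subset_Icc_right hT), fun t ht => h.eq t ⟨ht.1, ht.2.trans hT⟩⟩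

theorem IsMildOn.congr (h : IsMildOn S γ f z₀ z T) {w : ℝ → PhaseSpace A}
    (hw : EqOn w z (Icc 0 T)) : IsMildOn S γ f z₀ w T := by
  refine ⟨h.continuousOn.congr hw, fun t ht => ?_⟩
  rw [hw ht, h.eq t ht]
  congr 2
  refine intervalIntegral.integral_congr fun s hs => ?_
  rw [uIcc_of_le ht.1] at hs
  rw [hw ⟨hs.1, hs.2.trans ht.2⟩]

variable [CompleteSpace (GraphDomain A)] [CompleteSpace H]

theorem intervalIntegrable_duhamel (hS : IsC0Group S) (hf : MemL2Loc f) (hT : 0 ≤ T)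
    (hz : ContinuousOn z (Icc 0 T)) :
    IntervalIntegrable (fun s => S (-s) (nonlinearity γ (z s) (f s))) volume 0 T := by
  obtain ⟨r, hr⟩ := isCompact_Icc.exists_bound_of_continuousOn hz
  obtain ⟨K, hK0, hK⟩ := hS.exists_bound T
  have hfi := hf.intervalIntegrable hT
  rw [intervalIntegrable_iff_integrableOn_Icc_of_le hT] at hfi ⊢
  have hcont : Continuous fun a : ℝ × (PhaseSpace A × H) =>
      S (-a.1) (nonlinearity γ a.2.1 a.2.2) :=
    hS.continuous_apply continuous_fst.neg ((continuous_nonlinearity γ).comp continuous_snd)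
  have hm := aestronglyMeasurable_comp_prodMk hcont
    ((hz.aestronglyMeasurable measurableSet_Icc).prodMk hfi.aestronglyMeasurable)
  refine Integrable.mono' (g := fun s => K * ((6 * r ^ 2 + |γ|) * r + (2 * r * r + 1) * ‖f s‖))
    (((integrable_const _).add (hfi.norm.const_mul _)).const_mul _) hm ?_
  refine (ae_restrict_iff' measurableSet_Icc).2 (ae_of_all _ fun s hs => ?_)
  refine ((S (-s)).le_of_opNorm_le (hK _ ⟨by linarith [hs.2], by linarith [hs.1]⟩) _).trans ?_
  gcongr
  exact norm_nonlinearity_le γ (hr s hs) _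

/-- Two solutions lie in a common ball on the compact interval, where the Lipschitz bound applies
with kernel affine in `‖f‖`; Grönwall concludes. -/
theorem IsMildOn.eqOn (hS : IsC0Group S) (hf : MemL2Loc f) (hT : 0 ≤ T)
    (h : IsMildOn S γ f z₀ z T) {w : ℝ → PhaseSpace A} (hw : IsMildOn S γ f z₀ w T) :
    EqOn w z (Icc 0 T) := by
  obtain ⟨r₁, hr₁⟩ := isCompact_Icc.exists_bound_of_continuousOn h.continuousOn
  obtain ⟨r₂, hr₂⟩ := isCompact_Icc.exists_bound_of_continuousOn hw.continuousOn
  obtain ⟨K, hK0, hK⟩ := hS.exists_bound T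
  set r := max r₁ r₂
  have hr : 0 ≤ r := (norm_nonneg _).trans ((hr₁ 0 ⟨le_rfl, hT⟩).trans (le_max_left _ _))
  have hfi := (hf.intervalIntegrable hT).norm
  have hk : IntervalIntegrable (fun s => K * K * (6 * r ^ 2 + |γ| + 2 * r * ‖f s‖)) volume 0 T :=
    (intervalIntegrable_const.add (hfi.const_mul _)).const_mul _
  have hφc : ContinuousOn (fun t => ‖w t - z t‖) (Icc 0 T) :=
    (hw.continuousOn.sub h.continuousOn).norm
  have key := eq_zero_of_le_integral hT hk (fun s => by positivity) hφc
    (fun t _ => norm_nonneg _) fun t ht => ?_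
  · intro t ht
    exact sub_eq_zero.1 (norm_eq_zero.1 (key t ht))
  · have hsub : Icc 0 t ⊆ Icc 0 T := Icc_subset_Icc_right ht.2
    have hi1 := intervalIntegrable_duhamel (γ := γ) hS hf ht.1 (h.continuousOn.mono hsub)
    have hi2 := intervalIntegrable_duhamel (γ := γ) hS hf ht.1 (hw.continuousOn.mono hsub)
    have hKt : ‖S t‖ ≤ K := hK t ⟨by linarith [ht.1], ht.2⟩
    have e : w t - z t = S t (∫ s in (0 : ℝ)..t, (S (-s) (nonlinearity γ (w s) (f s))
        - S (-s) (nonlinearity γ (z s) (f s)))) := by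
      rw [hw.eq t ht, h.eq t ht, ← map_sub, add_sub_add_left_eq_sub,
        intervalIntegral.integral_sub hi2 hi1]
    have hki : IntervalIntegrable
        (fun s => K * (6 * r ^ 2 + |γ| + 2 * r * ‖f s‖) * ‖w s - z s‖) volume 0 t := by
      refine IntervalIntegrable.mul_continuousOn ?_ (by
        rw [uIcc_of_le ht.1]; exact hφc.mono hsub)
      exact intervalIntegrable_of_mem_Icc
        ((intervalIntegrable_const.add (hfi.const_mul _)).const_mul _) ht
    calc ‖w t - z t‖ ≤ K * ‖∫ s in (0 : ℝ)..t, (S (-s) (nonlinearity γ (w s) (f s))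
        - S (-s) (nonlinearity γ (z s) (f s)))‖ := by rw [e]; exact (S t).le_of_opNorm_le hKt _
      _ ≤ K * ∫ s in (0 : ℝ)..t, K * (6 * r ^ 2 + |γ| + 2 * r * ‖f s‖) * ‖w s - z s‖ := by
          gcongr
          refine intervalIntegral.norm_integral_le_of_norm_le ht.1 (ae_of_all _ fun s hs => ?_) hki
          have hs' : s ∈ Icc 0 T := ⟨hs.1.le, hs.2.trans ht.2⟩
          rw [← map_sub, mul_assoc]
          refine ((S (-s)).le_of_opNorm_le
            (hK _ ⟨by linarith [hs'.2], by linarith [hs'.1]⟩) _).trans ?_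
          gcongr
          exact norm_nonlinearity_sub_le γ ((hr₂ s hs').trans (le_max_right _ _))
            ((hr₁ s hs').trans (le_max_left _ _)) _
      _ = _ := by
          rw [← intervalIntegral.integral_const_mul]
          refine intervalIntegral.integral_congr fun s _ => ?_
          ring

end Nonlinearity

/-! ### Constraint and energy balance -/

section Invariants

open GraphDomain

variable {H : Type*} [NormedAddCommGroup H] [InnerProductSpace ℝ H] {A : H →ₗ.[ℝ] H}
  [CompleteSpace (GraphDomain A)] [CompleteSpace H] {S : ℝ → PhaseSpace A →L[ℝ] PhaseSpace A}
  {γ : ℝ} {f : ℝ → H} {z₀ : PhaseSpace A} {z : ℝ → PhaseSpace A} {T : ℝ}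
  {R Gn : ℕ → PhaseSpace A →L[ℝ] PhaseSpace A}

theorem IsMildOn.chain_rule {Y : Type*} [NormedAddCommGroup Y] [NormedSpace ℝ Y] [CompleteSpace Y]
    (h : IsMildOn S γ f z₀ z T) (hS : IsC0GroupGeneratedBy S (waveOperator A))
    (hreg : IsRegularization (waveOperator A) R Gn) (hf : MemL2Loc f)
    {Q : PhaseSpace A → Y} {Q' : PhaseSpace A → PhaseSpace A →L[ℝ] Y} {q : PhaseSpace A → Y}
    (hQ : ∀ x, HasFDerivAt Q (Q' x) x) (hQ'c : Continuous Q') (hqc : Continuous q)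
    (hQ'b : ∀ r : ℝ, ∃ C, ∀ x, ‖x‖ ≤ r → ‖Q' x‖ ≤ C)
    (hqb : ∀ r : ℝ, ∃ C, ∀ x, ‖x‖ ≤ r → ‖q x‖ ≤ C)
    (hG : ∀ x y, (x, y) ∈ (waveOperator A).graph → Q' x y = q x) {t : ℝ} (ht : t ∈ Icc 0 T) :
    IntervalIntegrable (fun s => q (z s) + Q' (z s) (nonlinearity γ (z s) (f s))) volume 0 t ∧
    Q (z t) = Q z₀ + ∫ s in (0 : ℝ)..t, (q (z s) + Q' (z s) (nonlinearity γ (z s) (f s))) := by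
  have := ConstrainedWave.chain_rule hS hreg hQ hQ'c hqc hQ'b hqb hG
    (intervalIntegrable_duhamel (γ := γ) hS.isC0Group hf (ht.1.trans ht.2) h.continuousOn) h.eq ht
  simpa only [hS.isC0Group.apply_neg_apply] using this

/-- The chain rule for quadratic `Q`, used for `‖u‖²`, `⟪u, v⟫` and the energy. In each case
self-adjointness or `u_t = v` removes the unbounded terms, which is what makes `q` continuous on the
whole phase space. -/
theorem IsMildOn.chain_rule_inner {E : Type*} [NormedAddCommGroup E] [InnerProductSpace ℝ E]
    (h : IsMildOn S γ f z₀ z T) (hS : IsC0GroupGeneratedBy S (waveOperator A))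
    (hreg : IsRegularization (waveOperator A) R Gn) (hf : MemL2Loc f)
    (L₁ L₂ : PhaseSpace A →L[ℝ] E) {q : PhaseSpace A → ℝ} (hqc : Continuous q)
    (hqb : ∀ r : ℝ, ∃ C, ∀ x, ‖x‖ ≤ r → ‖q x‖ ≤ C)
    (hG : ∀ x y, (x, y) ∈ (waveOperator A).graph → ⟪L₁ x, L₂ y⟫_ℝ + ⟪L₁ y, L₂ x⟫_ℝ = q x)
    {t : ℝ} (ht : t ∈ Icc 0 T) :
    IntervalIntegrable (fun s => q (z s) + (⟪L₁ (z s), L₂ (nonlinearity γ (z s) (f s))⟫_ℝ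
      + ⟪L₁ (nonlinearity γ (z s) (f s)), L₂ (z s)⟫_ℝ)) volume 0 t ∧
    ⟪L₁ (z t), L₂ (z t)⟫_ℝ = ⟪L₁ z₀, L₂ z₀⟫_ℝ + ∫ s in (0 : ℝ)..t, (q (z s)
      + (⟪L₁ (z s), L₂ (nonlinearity γ (z s) (f s))⟫_ℝ
        + ⟪L₁ (nonlinearity γ (z s) (f s)), L₂ (z s)⟫_ℝ)) := by
  let Q' : PhaseSpace A → PhaseSpace A →L[ℝ] ℝ := fun x =>
    (innerSL ℝ (L₁ x)).comp L₂ + (innerSL ℝ (L₂ x)).comp L₁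
  have hQ' : ∀ x y, Q' x y = ⟪L₁ x, L₂ y⟫_ℝ + ⟪L₁ y, L₂ x⟫_ℝ := fun x y => by
    rw [real_inner_comm (L₂ x)]; rfl
  have hQ'c : Continuous Q' := by fun_prop
  have hQ'b : ∀ x, ‖Q' x‖ ≤ ‖L₁‖ * ‖x‖ * ‖L₂‖ + ‖L₂‖ * ‖x‖ * ‖L₁‖ := by
    intro x
    refine (norm_add_le ((innerSL ℝ (L₁ x)).comp L₂) ((innerSL ℝ (L₂ x)).comp L₁)).trans
      (add_le_add ?_ ?_)
    · refine (ContinuousLinearMap.opNorm_comp_le _ _).trans ?_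
      rw [innerSL_apply_norm]
      gcongr
      exact L₁.le_opNorm x
    · refine (ContinuousLinearMap.opNorm_comp_le _ _).trans ?_
      rw [innerSL_apply_norm]
      gcongr
      exact L₂.le_opNorm x
  have key := h.chain_rule hS hreg hf (Q := fun x => ⟪L₁ x, L₂ x⟫_ℝ) (Q' := Q') (q := q)
    (fun x => by
      refine (HasFDerivAt.inner ℝ L₁.hasFDerivAt L₂.hasFDerivAt).congr_fderiv ?_
      ext y
      rw [hQ']
      simp [fderivInnerCLM_apply]) hQ'c hqc
    (fun r => ⟨‖L₁‖ * r * ‖L₂‖ + ‖L₂‖ * r * ‖L₁‖, fun x hx => (hQ'b x).trans (by gcongr)⟩) hqb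
    (fun x y hxy => by rw [hQ', hG x y hxy]) ht
  simpa only [hQ'] using key

theorem IsMildOn.pos_eq (h : IsMildOn S γ f z₀ z T) (hS : IsC0GroupGeneratedBy S (waveOperator A))
    (hreg : IsRegularization (waveOperator A) R Gn) (hf : MemL2Loc f) {t : ℝ}
    (ht : t ∈ Icc 0 T) : pos (z t) = pos z₀ + ∫ s in (0 : ℝ)..t, vel (z s) := by
  have key := (h.chain_rule hS hreg hf (Q := pos) (Q' := fun _ => posL A) (q := vel)
    (fun x => (posL A).hasFDerivAt) continuous_const continuous_vel
    (fun r => ⟨‖posL A‖, fun _ _ => le_rfl⟩)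
    (fun r => ⟨r, fun x hx => (norm_vel_le x).trans hx⟩)
    (fun x y hxy => ((mem_graph_waveOperator x y).1 hxy).1) ht).2
  simpa only [posL_apply, pos_nonlinearity, add_zero] using key

theorem IsMildOn.norm_pos_sq (h : IsMildOn S γ f z₀ z T)
    (hS : IsC0GroupGeneratedBy S (waveOperator A))
    (hreg : IsRegularization (waveOperator A) R Gn) (hf : MemL2Loc f) {t : ℝ}
    (ht : t ∈ Icc 0 T) :
    ‖pos (z t)‖ ^ 2 = ‖pos z₀‖ ^ 2 + ∫ s in (0 : ℝ)..t, 2 * ⟪pos (z s), vel (z s)⟫_ℝ := by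
  have key := (h.chain_rule_inner hS hreg hf (posL A) (posL A)
    (q := fun x => 2 * ⟪pos x, vel x⟫_ℝ)
    (continuous_const.mul (continuous_pos.inner continuous_vel))
    (fun r => ⟨2 * (r * r), fun x hx => by
      have hr : 0 ≤ r := (norm_nonneg _).trans hx
      rw [norm_mul, Real.norm_two]
      gcongr
      refine (norm_inner_le_norm _ _).trans ?_
      gcongr
      · exact (norm_pos_le x).trans hx
      · exact (norm_vel_le x).trans hx⟩)
    (fun x y hxy => by
      have := ((mem_graph_waveOperator x y).1 hxy).1
      rw [posL_apply, posL_apply, this, real_inner_comm (vel x)]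
      ring) ht).2
  simpa only [posL_apply, pos_nonlinearity, inner_zero_left, inner_zero_right, add_zero,
    real_inner_self_eq_norm_sq] using key

/-- The free flow contributes `‖v‖² - ‖A u‖²`, the cubic terms `(‖A u‖² - ‖v‖²) ‖u‖²`, and the
projected forcing `⟪f, u⟫ (1 - ‖u‖²)`, so `‖u‖² - 1` factors out of all but the damping. -/
theorem IsMildOn.inner_pos_vel (h : IsMildOn S γ f z₀ z T) (hA : IsSelfAdjoint A)
    (hS : IsC0GroupGeneratedBy S (waveOperator A))
    (hreg : IsRegularization (waveOperator A) R Gn) (hf : MemL2Loc f) {t : ℝ}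
    (ht : t ∈ Icc 0 T) :
    ⟪pos (z t), vel (z t)⟫_ℝ = ⟪pos z₀, vel z₀⟫_ℝ + ∫ s in (0 : ℝ)..t,
      ((‖opPos (z s)‖ ^ 2 - ‖vel (z s)‖ ^ 2 - ⟪f s, pos (z s)⟫_ℝ) * (‖pos (z s)‖ ^ 2 - 1)
        - γ * ⟪pos (z s), vel (z s)⟫_ℝ) := by
  have key := (h.chain_rule_inner hS hreg hf (posL A) (velL A)
    (q := fun x => ‖vel x‖ ^ 2 - ‖opPos x‖ ^ 2)
    ((continuous_vel.norm.pow 2).sub (continuous_opPos.norm.pow 2))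
    (fun r => ⟨r ^ 2 + r ^ 2, fun x hx => by
      refine (norm_sub_le _ _).trans ?_
      rw [norm_pow, norm_pow, norm_norm, norm_norm]
      have h1 := (norm_vel_le x).trans hx
      have h2 := (norm_opPos_le x).trans hx
      gcongr⟩)
    (fun x y hxy => by
      obtain ⟨h1, p, hp1, hp2⟩ := (mem_graph_waveOperator x y).1 hxy
      have h3 : ⟪pos x, op A p⟫_ℝ = ‖opPos x‖ ^ 2 := by
        have := inner_op_incl hA x.fst p
        rw [hp1] at this
        rw [← real_inner_self_eq_norm_sq]
        exact this.symm
      rw [posL_apply, posL_apply, velL_apply, velL_apply, h1, hp2, inner_neg_right, h3,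
        real_inner_self_eq_norm_sq]
      ring) ht).2
  simp only [posL_apply, velL_apply, pos_nonlinearity, inner_zero_left, add_zero] at key
  rw [key]
  congr 1
  refine intervalIntegral.integral_congr fun s _ => ?_
  simp only [vel_nonlinearity, tangentProj, inner_add_right, inner_sub_right, inner_neg_right,
    real_inner_smul_right, real_inner_self_eq_norm_sq]
  rw [real_inner_comm (f s)]
  ring

theorem IsMildOn.energy_eq_integral (h : IsMildOn S γ f z₀ z T) (hA : IsSelfAdjoint A)
    (hS : IsC0GroupGeneratedBy S (waveOperator A))
    (hreg : IsRegularization (waveOperator A) R Gn) (hf : MemL2Loc f) {t : ℝ}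
    (ht : t ∈ Icc 0 T) :
    IntervalIntegrable (fun s => ⟪vel (z s), vel (nonlinearity γ (z s) (f s))⟫_ℝ) volume 0 t ∧
    energy (z t) = energy z₀
      + ∫ s in (0 : ℝ)..t, ⟪vel (z s), vel (nonlinearity γ (z s) (f s))⟫_ℝ := by
  -- With `L z = (A u, v)` the energy is `‖L z‖² / 2`. The free contribution vanishes since `⟪A u, A
  -- v⟫` cancels `-⟪A² u, v⟫`.
  let L : PhaseSpace A →L[ℝ] WithLp 2 (H × H) :=
    ((WithLp.prodContinuousLinearEquiv 2 ℝ H H).symm : H × H →L[ℝ] WithLp 2 (H × H)).comp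
      ((opPosL A).prod (velL A))
  have hL : ∀ x y, ⟪L x, L y⟫_ℝ = ⟪opPos x, opPos y⟫_ℝ + ⟪vel x, vel y⟫_ℝ := fun _ _ => rfl
  have key := h.chain_rule_inner hS hreg hf L L (q := fun _ => 0) continuous_const
    (fun r => ⟨0, fun x _ => by simp⟩)
    (fun x y hxy => by
      obtain ⟨h1, p, hp1, hp2⟩ := (mem_graph_waveOperator x y).1 hxy
      have h3 : ⟪opPos x, opPos y⟫_ℝ = ⟪op A p, vel x⟫_ℝ := by
        rw [← hp1, ← h1]
        exact (inner_op_incl hA p y.fst).symm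
      rw [hL, hL, h3, real_inner_comm (opPos x), h3, hp2, inner_neg_right, inner_neg_left,
        real_inner_comm (vel x)]
      ring) ht
  have hL2 : ∀ x, ⟪L x, L x⟫_ℝ = 2 * energy x := fun x => by
    rw [hL, energy, real_inner_self_eq_norm_sq, real_inner_self_eq_norm_sq]; ring
  have hLN : ∀ s, 0 + (⟪L (z s), L (nonlinearity γ (z s) (f s))⟫_ℝ
      + ⟪L (nonlinearity γ (z s) (f s)), L (z s)⟫_ℝ)
      = 2 * ⟪vel (z s), vel (nonlinearity γ (z s) (f s))⟫_ℝ := fun s => by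
    rw [real_inner_comm (L (z s)), hL, opPos_nonlinearity, inner_zero_right]; ring
  simp only [hL2, hLN] at key
  rw [intervalIntegral.integral_const_mul] at key
  refine ⟨?_, by linarith [key.2]⟩
  simpa using key.1.const_mul (1 / 2)

/-- The sphere and its tangent bundle are invariant. -/
theorem IsMildOn.constraint (h : IsMildOn S γ f z₀ z T) (hA : IsSelfAdjoint A)
    (hS : IsC0GroupGeneratedBy S (waveOperator A))
    (hreg : IsRegularization (waveOperator A) R Gn) (hf : MemL2Loc f) (hu₀ : ‖pos z₀‖ = 1)
    (huv₀ : ⟪pos z₀, vel z₀⟫_ℝ = 0) {t : ℝ} (ht : t ∈ Icc 0 T) :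
    ‖pos (z t)‖ = 1 ∧ ⟪pos (z t), vel (z t)⟫_ℝ = 0 := by
  have hT : 0 ≤ T := ht.1.trans ht.2
  obtain ⟨r, hr⟩ := isCompact_Icc.exists_bound_of_continuousOn h.continuousOn
  have hr0 : 0 ≤ r := (norm_nonneg _).trans (hr 0 ⟨le_rfl, hT⟩)
  have hfi := hf.intervalIntegrable hT
  let a : ℝ → ℝ := fun s => ‖pos (z s)‖ ^ 2 - 1
  let b : ℝ → ℝ := fun s => ⟪pos (z s), vel (z s)⟫_ℝ
  let k : ℝ → ℝ := fun s => 2 + 2 * r ^ 2 + r * ‖f s‖ + |γ|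
  have hk : IntervalIntegrable k volume 0 T :=
    (intervalIntegrable_const.add (hfi.norm.const_mul _)).add intervalIntegrable_const
  have hk0 : ∀ s, 0 ≤ k s := fun s => by positivity
  have hpc := (continuous_pos (A := A)).comp_continuousOn h.continuousOn
  have hvc := (continuous_vel (A := A)).comp_continuousOn h.continuousOn
  have hac : ContinuousOn a (Icc 0 T) := (hpc.norm.pow 2).sub continuousOn_const
  have hbc : ContinuousOn b (Icc 0 T) := hpc.inner hvc
  -- The system for `(a, b)` is linear and homogeneous with zero initial data, and `k` dominates the
  -- sum of its coefficients.
  have key := eq_zero_of_le_integral hT hk hk0 (hac.abs.add hbc.abs)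
    (fun s _ => add_nonneg (abs_nonneg _) (abs_nonneg _)) (fun s hs => ?_) t ht
  · have h1 := abs_nonneg (a t)
    have h2 := abs_nonneg (b t)
    change |a t| + |b t| = 0 at key
    have h3 : a t = 0 := abs_eq_zero.1 (by linarith)
    have h4 : b t = 0 := abs_eq_zero.1 (by linarith)
    refine ⟨?_, h4⟩
    have h5 : ‖pos (z t)‖ ^ 2 = 1 := by simp only [a] at h3; linarith
    exact (pow_eq_one_iff_of_nonneg (norm_nonneg _) two_ne_zero).1 h5
  · have hsub : Icc 0 s ⊆ Icc 0 T := Icc_subset_Icc_right hs.2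
    have hui : uIcc 0 s = Icc 0 s := uIcc_of_le hs.1
    have hka := (intervalIntegrable_of_mem_Icc hk hs)
    have ha : |a s| ≤ ∫ τ in (0 : ℝ)..s, 2 * |b τ| := by
      have e : a s = ∫ τ in (0 : ℝ)..s, 2 * b τ := by
        simp only [a]
        rw [h.norm_pos_sq hS hreg hf hs, hu₀]
        simp only [b]
        ring
      rw [e, ← Real.norm_eq_abs]
      refine intervalIntegral.norm_integral_le_of_norm_le hs.1 (ae_of_all _ fun τ _ => ?_)
        (ContinuousOn.intervalIntegrable (by rw [hui]; exact (hbc.mono hsub).abs.const_mul 2))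
      rw [norm_mul, Real.norm_two, Real.norm_eq_abs]
    have hint : IntervalIntegrable (fun τ => (2 * r ^ 2 + r * ‖f τ‖) * |a τ| + |γ| * |b τ|)
        volume 0 s := by
      refine IntervalIntegrable.add (IntervalIntegrable.mul_continuousOn ?_ ?_) ?_
      · exact intervalIntegrable_of_mem_Icc
          (intervalIntegrable_const.add (hfi.norm.const_mul _)) hs
      · rw [hui]; exact (hac.mono hsub).abs
      · exact ContinuousOn.intervalIntegrable
          (by rw [hui]; exact (hbc.mono hsub).abs.const_mul _)
    have hb : |b s| ≤ ∫ τ in (0 : ℝ)..s, ((2 * r ^ 2 + r * ‖f τ‖) * |a τ| + |γ| * |b τ|) := by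
      have e : b s = ∫ τ in (0 : ℝ)..s, ((‖opPos (z τ)‖ ^ 2 - ‖vel (z τ)‖ ^ 2
          - ⟪f τ, pos (z τ)⟫_ℝ) * a τ - γ * b τ) := by
        simp only [b]
        rw [h.inner_pos_vel hA hS hreg hf hs, huv₀, zero_add]
      rw [e, ← Real.norm_eq_abs]
      refine intervalIntegral.norm_integral_le_of_norm_le hs.1 (ae_of_all _ fun τ hτ => ?_) hint
      have hz := hr τ (hsub ⟨hτ.1.le, hτ.2⟩)
      have h1 : |‖opPos (z τ)‖ ^ 2 - ‖vel (z τ)‖ ^ 2 - ⟪f τ, pos (z τ)⟫_ℝ|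
          ≤ 2 * r ^ 2 + r * ‖f τ‖ := by
        have h2 : ‖opPos (z τ)‖ ^ 2 ≤ r ^ 2 := by
          gcongr; exact (norm_opPos_le _).trans hz
        have h3 : ‖vel (z τ)‖ ^ 2 ≤ r ^ 2 := by
          gcongr; exact (norm_vel_le _).trans hz
        have h4 : |⟪f τ, pos (z τ)⟫_ℝ| ≤ r * ‖f τ‖ := by
          refine (abs_real_inner_le_norm _ _).trans ?_
          rw [mul_comm]
          gcongr
          exact (norm_pos_le _).trans hz
        have h5 := abs_le.1 h4
        rw [abs_le]
        constructor <;> nlinarith [sq_nonneg ‖opPos (z τ)‖, sq_nonneg ‖vel (z τ)‖]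
      rw [Real.norm_eq_abs]
      refine (abs_sub _ _).trans ?_
      rw [abs_mul, abs_mul]
      gcongr
    change |a s| + |b s| ≤ ∫ τ in (0 : ℝ)..s, k τ * (|a τ| + |b τ|)
    have hib : IntervalIntegrable (fun τ => 2 * |b τ|) volume 0 s :=
      ContinuousOn.intervalIntegrable (by rw [hui]; exact (hbc.mono hsub).abs.const_mul 2)
    calc |a s| + |b s| ≤ (∫ τ in (0 : ℝ)..s, 2 * |b τ|)
          + ∫ τ in (0 : ℝ)..s, ((2 * r ^ 2 + r * ‖f τ‖) * |a τ| + |γ| * |b τ|) :=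
          add_le_add ha hb
      _ = ∫ τ in (0 : ℝ)..s, (2 * |b τ|
          + ((2 * r ^ 2 + r * ‖f τ‖) * |a τ| + |γ| * |b τ|)) :=
          (intervalIntegral.integral_add hib hint).symm
      _ ≤ _ := by
          refine intervalIntegral.integral_mono_on hs.1 (hib.add hint)
            (hka.mul_continuousOn (by rw [hui]; exact ((hac.abs.add hbc.abs).mono hsub)))
            fun τ _ => ?_
          simp only [k]
          have h1 := abs_nonneg (a τ)
          have h2 := abs_nonneg (b τ)
          have h3 := abs_nonneg γ
          have h4 : 0 ≤ r * ‖f τ‖ := by positivity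
          nlinarith [sq_nonneg r, mul_nonneg h3 h1, mul_nonneg h4 h2,
            mul_nonneg (sq_nonneg r) h2]

/-- The energy balance of a mild solution. -/
theorem IsMildOn.energy_eq (h : IsMildOn S γ f z₀ z T) (hA : IsSelfAdjoint A)
    (hS : IsC0GroupGeneratedBy S (waveOperator A))
    (hreg : IsRegularization (waveOperator A) R Gn) (hf : MemL2Loc f) (hu₀ : ‖pos z₀‖ = 1)
    (huv₀ : ⟪pos z₀, vel z₀⟫_ℝ = 0) {t : ℝ} (ht : t ∈ Icc 0 T) :
    IntervalIntegrable (fun s => ‖vel (z s)‖ ^ 2) volume 0 t ∧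
    IntervalIntegrable (fun s => ⟪vel (z s), f s⟫_ℝ) volume 0 t ∧
    energy (z t) = energy z₀ - γ * (∫ s in (0 : ℝ)..t, ‖vel (z s)‖ ^ 2)
      + ∫ s in (0 : ℝ)..t, ⟪vel (z s), f s⟫_ℝ := by
  obtain ⟨h1, h2⟩ := h.energy_eq_integral hA hS hreg hf ht
  have hui : uIcc 0 t = Icc 0 t := uIcc_of_le ht.1
  have hsub : Icc 0 t ⊆ Icc 0 T := Icc_subset_Icc_right ht.2
  have hvc := ((continuous_vel (A := A)).comp_continuousOn h.continuousOn).mono hsub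
  have hv : IntervalIntegrable (fun s => ‖vel (z s)‖ ^ 2) volume 0 t :=
    ContinuousOn.intervalIntegrable (by rw [hui]; exact hvc.norm.pow 2)
  -- As `⟪u, v⟫ = 0`, both cubic terms and the normal part of `f` are orthogonal to `v`.
  have hcongr : ∀ s ∈ Icc 0 t, ⟪vel (z s), vel (nonlinearity γ (z s) (f s))⟫_ℝ
      = -γ * ‖vel (z s)‖ ^ 2 + ⟪vel (z s), f s⟫_ℝ := by
    intro s hs
    have h3 := (h.constraint hA hS hreg hf hu₀ huv₀ (hsub hs)).2
    rw [real_inner_comm] at h3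
    simp only [vel_nonlinearity, tangentProj, inner_add_right, inner_sub_right, inner_neg_right,
      real_inner_smul_right, real_inner_self_eq_norm_sq, h3]
    ring
  have hfv : IntervalIntegrable (fun s => ⟪vel (z s), f s⟫_ℝ) volume 0 t := by
    refine (h1.add (hv.const_mul γ)).congr fun s hs => ?_
    rw [uIoc_of_le ht.1] at hs
    rw [hcongr s ⟨hs.1.le, hs.2⟩]
    ring
  refine ⟨hv, hfv, ?_⟩
  rw [h2, intervalIntegral.integral_congr (g := fun s => -γ * ‖vel (z s)‖ ^ 2
    + ⟪vel (z s), f s⟫_ℝ) (fun s hs => hcongr s (by rwa [hui] at hs)),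
    intervalIntegral.integral_add (hv.const_mul _) hfv, intervalIntegral.integral_const_mul]
  ring

end Invariants

/-! ### Global existence by truncation and a priori bounds -/

section Existence

open GraphDomain

/-- The radial retraction of a normed space onto the closed ball of radius `r`. -/
def radialRetract {X : Type*} [NormedAddCommGroup X] [NormedSpace ℝ X] (r : ℝ) (x : X) : X :=
  (r / max r ‖x‖) • x

theorem radialRetract_of_norm_le {X : Type*} [NormedAddCommGroup X] [NormedSpace ℝ X] {r : ℝ}
    (hr : 0 < r) {x : X} (hx : ‖x‖ ≤ r) : radialRetract r x = x := by
  rw [radialRetract, max_eq_left hx, div_self hr.ne', one_smul]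

theorem norm_radialRetract_le {X : Type*} [NormedAddCommGroup X] [NormedSpace ℝ X] {r : ℝ}
    (hr : 0 < r) (x : X) : ‖radialRetract r x‖ ≤ r := by
  have hm : 0 < max r ‖x‖ := hr.trans_le (le_max_left _ _)
  rw [radialRetract, norm_smul, Real.norm_of_nonneg (by positivity), div_mul_eq_mul_div,
    div_le_iff₀ hm]
  gcongr
  exact le_max_right _ _

/-- One `‖x - y‖` comes from moving the point at a fixed scaling factor, the other from the change
of the factor; no inner product is used. -/
theorem norm_radialRetract_sub_le {X : Type*} [NormedAddCommGroup X] [NormedSpace ℝ X] {r : ℝ}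
    (hr : 0 < r) (x y : X) : ‖radialRetract r x - radialRetract r y‖ ≤ 2 * ‖x - y‖ := by
  set m := max r ‖x‖
  set n := max r ‖y‖
  have hm : 0 < m := hr.trans_le (le_max_left _ _)
  have hn : 0 < n := hr.trans_le (le_max_left _ _)
  have e : radialRetract r x - radialRetract r y = (r / m) • (x - y) + (r / m - r / n) • y := by
    simp only [radialRetract, smul_sub, sub_smul]; abel
  have h1 : r / m ≤ 1 := div_le_one_of_le₀ (le_max_left _ _) hm.le
  have h2 : |r / m - r / n| * ‖y‖ ≤ ‖x - y‖ := by
    have e2 : r / m - r / n = (r / m) * ((n - m) / n) := by field_simp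
    have h3 : |n - m| ≤ ‖x - y‖ := by
      rw [abs_sub_comm]
      refine le_trans ?_ (abs_norm_sub_norm_le x y)
      simpa [m, n, max_comm r] using abs_max_sub_max_le_abs ‖x‖ ‖y‖ r
    rw [e2, abs_mul, abs_of_pos (div_pos hr hm), abs_div, abs_of_pos hn, mul_assoc]
    have h4 : |n - m| / n * ‖y‖ ≤ |n - m| := by
      rw [div_mul_eq_mul_div, div_le_iff₀ hn]
      gcongr
      exact le_max_right _ _
    calc _ ≤ 1 * |n - m| := by gcongr
      _ ≤ _ := by linarith
  rw [e]
  calc _ ≤ ‖(r / m) • (x - y)‖ + ‖(r / m - r / n) • y‖ := norm_add_le _ _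
    _ = r / m * ‖x - y‖ + |r / m - r / n| * ‖y‖ := by
      rw [norm_smul, norm_smul, Real.norm_of_nonneg (by positivity), Real.norm_eq_abs]
    _ ≤ 1 * ‖x - y‖ + ‖x - y‖ := by gcongr
    _ = _ := by ring

theorem continuous_radialRetract {X : Type*} [NormedAddCommGroup X] [NormedSpace ℝ X] {r : ℝ}
    (hr : 0 < r) : Continuous (radialRetract r : X → X) :=
  (LipschitzWith.of_dist_le_mul (K := 2) fun x y => by
    rw [dist_eq_norm, dist_eq_norm]; exact norm_radialRetract_sub_le hr x y).continuous

variable {H : Type*} [NormedAddCommGroup H] [InnerProductSpace ℝ H] {A : H →ₗ.[ℝ] H}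
  [CompleteSpace (GraphDomain A)] [CompleteSpace H] {S : ℝ → PhaseSpace A →L[ℝ] PhaseSpace A}
  {γ : ℝ} {f : ℝ → H} {z₀ : PhaseSpace A} {z : ℝ → PhaseSpace A} {T : ℝ}
  {R Gn : ℕ → PhaseSpace A →L[ℝ] PhaseSpace A}

/-- The a priori bound following from the energy balance. -/
theorem IsMildOn.norm_sq_le (h : IsMildOn S γ f z₀ z T) (hA : IsSelfAdjoint A)
    (hS : IsC0GroupGeneratedBy S (waveOperator A))
    (hreg : IsRegularization (waveOperator A) R Gn) (hf : MemL2Loc f) (hγ : 0 ≤ γ)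
    (hu₀ : ‖pos z₀‖ = 1) (huv₀ : ⟪pos z₀, vel z₀⟫_ℝ = 0) {l : ℝ}
    (hl : ∫ s in (0 : ℝ)..T, ‖f s‖ ≤ l) {t : ℝ} (ht : t ∈ Icc 0 T) :
    ‖z t‖ ^ 2 ≤ 4 * energy z₀ + 4 * l ^ 2 + 1 := by
  have hT : 0 ≤ T := ht.1.trans ht.2
  have hfi := (hf.intervalIntegrable hT).norm
  have hE : ∀ x : PhaseSpace A, ‖vel x‖ ^ 2 ≤ 2 * energy x := fun x => by
    rw [energy]; nlinarith [sq_nonneg ‖opPos x‖]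
  have hEc : ContinuousOn (fun t => energy (z t)) (Icc 0 T) := by
    have h1 := (continuous_opPos (A := A)).comp_continuousOn h.continuousOn
    have h2 := (continuous_vel (A := A)).comp_continuousOn h.continuousOn
    exact continuousOn_const.mul ((h1.norm.pow 2).add (h2.norm.pow 2))
  obtain ⟨t₁, ht₁, hmax⟩ := isCompact_Icc.exists_isMaxOn ⟨0, left_mem_Icc.2 hT⟩ hEc
  have hle : ∀ s ∈ Icc 0 T, energy (z s) ≤ energy (z t₁) := fun s hs => hmax hs
  obtain ⟨-, hfv, he⟩ := h.energy_eq hA hS hreg hf hu₀ huv₀ ht₁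
  set m := Real.sqrt (2 * energy (z t₁))
  have hE0 : 0 ≤ 2 * energy (z t₁) := (sq_nonneg _).trans (hE (z t₁))
  have hm : m ^ 2 = 2 * energy (z t₁) := Real.sq_sqrt hE0
  have hm0 : 0 ≤ m := Real.sqrt_nonneg _
  have hvm : ∀ s ∈ Icc 0 T, ‖vel (z s)‖ ≤ m := fun s hs =>
    Real.le_sqrt_of_sq_le ((hE _).trans (by linarith [hle s hs]))
  have hfi1 := intervalIntegrable_of_mem_Icc hfi ht₁
  have h1 : ∫ s in (0 : ℝ)..t₁, ⟪vel (z s), f s⟫_ℝ ≤ m * l := by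
    calc _ ≤ ∫ s in (0 : ℝ)..t₁, m * ‖f s‖ := by
          refine intervalIntegral.integral_mono_on ht₁.1 hfv (hfi1.const_mul m) fun s hs => ?_
          refine (real_inner_le_norm _ _).trans ?_
          gcongr
          exact hvm s ⟨hs.1, hs.2.trans ht₁.2⟩
      _ = m * ∫ s in (0 : ℝ)..t₁, ‖f s‖ := intervalIntegral.integral_const_mul _ _
      _ ≤ m * ∫ s in (0 : ℝ)..T, ‖f s‖ := by
          gcongr
          exact intervalIntegral.integral_mono_interval le_rfl ht₁.1 ht₁.2
            (ae_of_all _ fun s => norm_nonneg _) hfi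
      _ ≤ m * l := by gcongr
  have h2 : 0 ≤ γ * ∫ s in (0 : ℝ)..t₁, ‖vel (z s)‖ ^ 2 :=
    mul_nonneg hγ (intervalIntegral.integral_nonneg ht₁.1 fun s _ => sq_nonneg _)
  -- The work of `f` is at most `m l ≤ m² / 4 + l²`, and `m² / 4` is half the maximal energy,
  -- absorbed on the left.
  have h3 : energy (z t₁) ≤ 2 * energy z₀ + 2 * l ^ 2 := by
    nlinarith [sq_nonneg (m / 2 - l)]
  have h4 := hle t ht
  have h5 := (h.constraint hA hS hreg hf hu₀ huv₀ ht).1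
  have h6 : ‖z t‖ ^ 2 = 2 * energy (z t) + 1 := by
    rw [phase_norm_sq, h5, energy]; ring
  linarith

theorem exists_isMildOn (hA : IsSelfAdjoint A)
    (hS : IsC0GroupGeneratedBy S (waveOperator A))
    (hreg : IsRegularization (waveOperator A) R Gn) (hf : MemL2Loc f) (hγ : 0 ≤ γ)
    (hu₀ : ‖pos z₀‖ = 1) (huv₀ : ⟪pos z₀, vel z₀⟫_ℝ = 0) (hT : 0 ≤ T) :
    ∃ z, IsMildOn S γ f z₀ z T := by
  have hG := hS.isC0Group
  have hfi := hf.intervalIntegrable hT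
  set l := ∫ s in (0 : ℝ)..T, ‖f s‖
  have hE₀ : 0 ≤ energy z₀ := by unfold energy; positivity
  -- The strict inequality against the bound of `IsMildOn.norm_sq_le` is what prevents the solution
  -- from reaching the sphere of radius `r`.
  obtain ⟨r, hr0, hr⟩ : ∃ r : ℝ, 0 < r ∧ 4 * energy z₀ + 4 * l ^ 2 + 1 < r ^ 2 :=
    ⟨4 * energy z₀ + 4 * l ^ 2 + 2, by positivity, by nlinarith [sq_nonneg l]⟩
  obtain ⟨K, hK0, hK⟩ := hG.exists_bound T
  have hK' : ∀ s ∈ Icc 0 T, ∀ x, ‖S s x‖ ≤ K * ‖x‖ := fun s hs x =>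
    (S s).le_of_opNorm_le (hK s ⟨by linarith [hs.1], hs.2⟩) x
  have hKn : ∀ s ∈ Icc 0 T, ∀ x, ‖S (-s) x‖ ≤ K * ‖x‖ := fun s hs x =>
    (S (-s)).le_of_opNorm_le (hK _ ⟨by linarith [hs.2], by linarith [hs.1]⟩) x
  -- The truncated equation is solved for `w(t) = S(-t) z(t)`. The factor `2 * K` in the Lipschitz
  -- kernel comes from the retraction and from `S s`, the outer `K` from `S (-s)`.
  obtain ⟨w, hwc, hw⟩ := exists_integral_equation
    (G := fun s x => S (-s) (nonlinearity γ (radialRetract r (S s x)) (f s)))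
    (k := fun s => K * ((6 * r ^ 2 + |γ| + 2 * r * ‖f s‖) * (2 * K))) hT
    (((intervalIntegrable_const.add (hfi.norm.const_mul _)).mul_const _).const_mul _)
    (fun s => by positivity)
    (fun s hs x y => by
      rw [← map_sub]
      refine (hKn s hs _).trans ?_
      rw [mul_assoc, mul_assoc]
      gcongr
      refine (norm_nonlinearity_sub_le γ (norm_radialRetract_le hr0 _)
        (norm_radialRetract_le hr0 _) _).trans ?_
      gcongr
      refine (norm_radialRetract_sub_le hr0 _ _).trans ?_
      rw [mul_assoc, ← map_sub]
      gcongr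
      exact hK' s hs _)
    (fun x hx => intervalIntegrable_duhamel hG hf hT
      ((continuous_radialRetract hr0).comp (hG.continuous_apply continuous_id hx)).continuousOn)
    z₀
  let z : ℝ → PhaseSpace A := fun t => S t (w t)
  have hzc : Continuous z := hG.continuous_apply continuous_id hwc
  have hmild : ∀ τ ∈ Icc 0 T, (∀ t ∈ Icc 0 τ, ‖z t‖ ≤ r) → IsMildOn S γ f z₀ z τ := by
    intro τ hτ hb
    refine ⟨hzc.continuousOn, fun t ht => ?_⟩
    change S t (w t) = _
    rw [hw t ⟨ht.1, ht.2.trans hτ.2⟩]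
    congr 2
    refine intervalIntegral.integral_congr fun s hs => ?_
    rw [uIcc_of_le ht.1] at hs
    change S (-s) (nonlinearity γ (radialRetract r (z s)) (f s)) = _
    rw [radialRetract_of_norm_le hr0 (hb s ⟨hs.1, hs.2.trans ht.2⟩)]
  have hz0 : z 0 = z₀ := by
    simp only [z]
    rw [hG.apply_zero, hw 0 ⟨le_rfl, hT⟩]; simp
  have hz0r : ‖z 0‖ ≤ r := by
    refine abs_le_of_sq_le_sq' ?_ hr0.le |>.2
    rw [hz0, phase_norm_sq, hu₀]
    refine le_trans ?_ hr.le
    rw [energy]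
    nlinarith [sq_nonneg ‖opPos z₀‖, sq_nonneg ‖vel z₀‖, sq_nonneg l]
  have hcross : ∀ t ∈ Icc 0 T, r < ‖z t‖ → ∃ s ∈ Icc 0 t, ‖z s‖ = r := fun t ht hrt =>
    intermediate_value_Icc ht.1 hzc.norm.continuousOn ⟨hz0r, hrt.le⟩
  suffices hb : ∀ t ∈ Icc 0 T, ‖z t‖ ≤ r from ⟨z, hmild T ⟨hT, le_rfl⟩ hb⟩
  by_contra! hcon
  obtain ⟨t₁, ht₁, hrt₁⟩ := hcon
  obtain ⟨s₁, hs₁, hs₁r⟩ := hcross t₁ ht₁ hrt₁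
  have hcomp : IsCompact (Icc 0 T ∩ {t | ‖z t‖ = r}) :=
    isCompact_Icc.inter_right (isClosed_eq hzc.norm continuous_const)
  -- Up to the first time `τ` with `‖z τ‖ = r` the truncation is inactive, so `z` is a true mild
  -- solution there and the a priori bound contradicts `‖z τ‖ = r`.
  obtain ⟨τ, ⟨hτ, hτr⟩, hleast⟩ := hcomp.exists_isLeast ⟨s₁, ⟨hs₁.1, hs₁.2.trans ht₁.2⟩, hs₁r⟩
  have hτr' : ‖z τ‖ = r := hτr
  have hbτ : ∀ t ∈ Icc 0 τ, ‖z t‖ ≤ r := by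
    intro t ht
    by_contra! hrt
    have htT : t ∈ Icc 0 T := ⟨ht.1, ht.2.trans hτ.2⟩
    obtain ⟨s, hs, hsr⟩ := hcross t htT hrt
    have h1 : τ ≤ s := hleast ⟨⟨hs.1, hs.2.trans htT.2⟩, hsr⟩
    have h2 : t = τ := le_antisymm ht.2 (h1.trans hs.2)
    rw [h2, hτr'] at hrt
    exact lt_irrefl _ hrt
  have h1 := (hmild τ hτ hbτ).norm_sq_le hA hS hreg hf hγ hu₀ huv₀ (l := l)
    (intervalIntegral.integral_mono_interval le_rfl hτ.1 hτ.2
      (ae_of_all _ fun s => norm_nonneg _) hfi.norm) ⟨hτ.1, le_rfl⟩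
  rw [hτr'] at h1
  linarith

/-- Solutions on `[0, n]` are glued by uniqueness; the value at `t` is read off from the one on `[0,
⌈t⌉]`. -/
theorem exists_forall_isMildOn (hA : IsSelfAdjoint A)
    (hS : IsC0GroupGeneratedBy S (waveOperator A))
    (hreg : IsRegularization (waveOperator A) R Gn) (hf : MemL2Loc f) (hγ : 0 ≤ γ)
    (hu₀ : ‖pos z₀‖ = 1) (huv₀ : ⟪pos z₀, vel z₀⟫_ℝ = 0) :
    ∃ z, ∀ T, 0 ≤ T → IsMildOn S γ f z₀ z T := by
  choose Z hZ using fun n : ℕ =>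
    exists_isMildOn (T := n) hA hS hreg hf hγ hu₀ huv₀ n.cast_nonneg
  refine ⟨fun t => Z ⌈t⌉₊ t, fun T hT => ?_⟩
  refine ((hZ ⌈T⌉₊).mono (Nat.le_ceil T)).congr fun t ht => ?_
  have hle : (⌈t⌉₊ : ℝ) ≤ ⌈T⌉₊ := by exact_mod_cast Nat.ceil_mono ht.2
  exact ((hZ ⌈T⌉₊).mono hle).eqOn hS.isC0Group hf (Nat.cast_nonneg _) (hZ ⌈t⌉₊)
    ⟨ht.1, Nat.le_ceil t⟩

end Existence

/-! ### From the integrated form to solutions and back -/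

section Solutions

open GraphDomain

variable {H : Type*} [NormedAddCommGroup H] [InnerProductSpace ℝ H] {A : H →ₗ.[ℝ] H}
  [CompleteSpace (GraphDomain A)] [CompleteSpace H] {S : ℝ → PhaseSpace A →L[ℝ] PhaseSpace A}
  {γ : ℝ} {f : ℝ → H} {z₀ : PhaseSpace A} {z : ℝ → PhaseSpace A}
  {R Gn : ℕ → PhaseSpace A →L[ℝ] PhaseSpace A}

theorem IsC0Group.duhamel_eq (hS : IsC0Group S) (hf : MemL2Loc f) {t : ℝ} (ht : 0 ≤ t)
    (hz : ContinuousOn z (Icc 0 t)) :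
    IntervalIntegrable (fun s => S (t - s) (nonlinearity γ (z s) (f s))) volume 0 t ∧
    S t z₀ + ∫ s in (0 : ℝ)..t, S (t - s) (nonlinearity γ (z s) (f s))
      = S t (z₀ + ∫ s in (0 : ℝ)..t, S (-s) (nonlinearity γ (z s) (f s))) := by
  have hi := intervalIntegrable_duhamel (γ := γ) hS hf ht hz
  have e : ∀ s x, S (t - s) x = S t (S (-s) x) := fun s x => by
    rw [sub_eq_add_neg, hS.apply_add]
  simp only [e]
  refine ⟨?_, ?_⟩
  · rw [intervalIntegrable_iff] at hi ⊢
    exact (S t).integrable_comp hi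
  · rw [_root_.map_add, ContinuousLinearMap.intervalIntegral_comp_comm _ hi]

/-- The group hidden in the definition of a mild solution is identified with `S`, since the
generator is densely defined. -/
theorem IsSolution.isMildOn (hf : MemL2Loc f) (hS : IsC0GroupGeneratedBy S (waveOperator A))
    (hreg : IsRegularization (waveOperator A) R Gn) (h : IsSolution γ f z₀ z) (T : ℝ) :
    IsMildOn S γ f z₀ z T := by
  obtain ⟨S', hS', hz⟩ := h.isMildSolution
  obtain rfl := hS'.eq_of_dense hS hreg.dense_domain
  refine ⟨h.continuousOn.mono Icc_subset_Ici_self, fun t ht => ?_⟩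
  rw [← (hS.isC0Group.duhamel_eq hf ht.1 (h.continuousOn.mono Icc_subset_Ici_self)).2]
  exact (hz t ht.1).2

theorem isSolution_of_forall_isMildOn (hA : IsSelfAdjoint A) (hf : MemL2Loc f)
    (hS : IsC0GroupGeneratedBy S (waveOperator A))
    (hreg : IsRegularization (waveOperator A) R Gn) (hu₀ : ‖pos z₀‖ = 1)
    (huv₀ : ⟪pos z₀, vel z₀⟫_ℝ = 0) (h : ∀ T, 0 ≤ T → IsMildOn S γ f z₀ z T) :
    IsSolution γ f z₀ z := by
  have hzc : ContinuousOn z (Ici 0) := by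
    intro t ht
    have ht' : (0 : ℝ) ≤ t := ht
    have h1 := (h (t + 1) (by linarith)).continuousOn t ⟨ht, by linarith⟩
    refine h1.mono_of_mem_nhdsWithin ?_
    rw [← Ici_inter_Iic]
    exact inter_mem self_mem_nhdsWithin (mem_nhdsWithin_of_mem_nhds (Iic_mem_nhds (by linarith)))
  -- Freezing the velocity at negative times makes `U` a `C¹` function on the whole line; the
  -- one-sided statements for `u` follow by restriction.
  let v : ℝ → H := fun t => vel (z (max t 0))
  have hv : Continuous v := by
    refine continuous_vel.comp (hzc.comp_continuous (by fun_prop) fun t => ?_)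
    exact le_max_right t 0
  let U : ℝ → H := fun t => pos z₀ + ∫ s in (0 : ℝ)..t, v s
  have hU : ∀ t, HasDerivAt U (v t) t := fun t =>
    (hv.integral_hasStrictDerivAt 0 t).hasDerivAt.const_add _
  have hUz : ∀ t ∈ Ici (0 : ℝ), pos (z t) = U t := by
    intro t ht
    rw [(h t ht).pos_eq hS hreg hf ⟨ht, le_rfl⟩]
    simp only [U]
    congr 1
    refine intervalIntegral.integral_congr fun s hs => ?_
    rw [uIcc_of_le ht] at hs
    simp only [v]
    rw [max_eq_left hs.1]
  refine ⟨hzc, ?_, fun t ht => ?_, fun t ht => ?_, S, hS, fun t ht => ?_⟩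
  · have hU1 : ContDiff ℝ 1 U := by
      rw [contDiff_one_iff_deriv]
      refine ⟨fun t => (hU t).differentiableAt, ?_⟩
      rwa [show deriv U = v from funext fun t => (hU t).deriv]
    exact hU1.contDiffOn.congr hUz
  · simpa using ((h t ht).constraint hA hS hreg hf hu₀ huv₀ ⟨ht, le_rfl⟩).1
  · have h1 := (hU t).hasDerivWithinAt (s := Ici 0)
    have h2 : v t = vel (z t) := by simp only [v]; rw [max_eq_left ht]
    rw [h2] at h1
    exact h1.congr hUz (hUz t ht)
  · obtain ⟨h1, h2⟩ := hS.isC0Group.duhamel_eq (γ := γ) (z₀ := z₀) hf ht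
      (hzc.mono Icc_subset_Ici_self)
    exact ⟨h1, by rw [h2]; exact (h t ht).eq t ⟨ht, le_rfl⟩⟩

end Solutions

end ConstrainedWave

end

open ConstrainedWave in
theorem theorem2p1 {H : Type*} [NormedAddCommGroup H] [InnerProductSpace ℝ H] [CompleteSpace H]
    [TopologicalSpace.SeparableSpace H]
    (A₀ : H →ₗ.[ℝ] H) (hA₀ : IsNonnegSelfAdjoint A₀)
    (γ : ℝ) (hγ : 0 < γ)
    (f : ℝ → H) (hf : MemL2Loc f)
    (z₀ : PhaseSpace A₀) (hu₀ : ‖pos z₀‖ = 1) (huv₀ : ⟪pos z₀, vel z₀⟫_ℝ = 0) :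
    ∃ z : ℝ → PhaseSpace A₀,
      IsSolution γ f z₀ z ∧
      (∀ w : ℝ → PhaseSpace A₀, IsSolution γ f z₀ w → EqOn w z (Ici 0)) ∧
      ∀ t : ℝ, 0 ≤ t →
        IntervalIntegrable (fun s => ‖vel (z s)‖ ^ 2) volume 0 t ∧
        IntervalIntegrable (fun s => ⟪vel (z s), f s⟫_ℝ) volume 0 t ∧
        energy (z t) = energy z₀ - γ * (∫ s in (0 : ℝ)..t, ‖vel (z s)‖ ^ 2)
          + ∫ s in (0 : ℝ)..t, ⟪vel (z s), f s⟫_ℝ := by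
  have hA := hA₀.isSelfAdjoint
  have : CompleteSpace (GraphDomain A₀) := GraphDomain.completeSpace A₀ hA.isClosed
  obtain ⟨⟨R, Gn, hreg⟩, S, hS⟩ := exists_regularization_and_group hA
  obtain ⟨z, hz⟩ := exists_forall_isMildOn hA hS hreg hf hγ.le hu₀ huv₀
  refine ⟨z, isSolution_of_forall_isMildOn hA hf hS hreg hu₀ huv₀ hz, fun w hw t ht => ?_,
    fun t ht => (hz t ht).energy_eq hA hS hreg hf hu₀ huv₀ ⟨ht, le_rfl⟩⟩
  exact (hz t ht).eqOn hS.isC0Group hf ht (hw.isMildOn hf hS hreg t) ⟨ht, le_rfl⟩
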